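/- A knot projection is a closed curve on the sphere $S^2$ whose only multiple points are finitely many transverse double points, called crossings; $C$ denotes the set of crossings. The connected components of the complement of the curve are the regions; $R$ denotes the set of regions. An edge is a connected component of the curve minus its crossings. A region crossing change (RCC) on a region changes every crossing on the boundary of that region. For $T\subseteq R$, let $\phi(T)\subseteq C$ be the set of crossings that are changed when RCC is performed on all regions of $T$, that is, the set of crossings that lie on the boundary of an odd number of regions in $T$. The projection is irreducible if every crossing lies on the boundary of four different regions. A checkerboard coloring colors each region black or white such that different regions sharing an edge have different colors. Write $P(X)$ for the power set of $X$. Let an irreducible knot projection with a checkerboard coloring be given, let $b$ be a black region, $w$ a white region, and let $S=R\setminus\{b,w\}$. Then: 1. The map $\phi\colon P(S)\to P(C)$ is bijective. 2. With the operations $a\vee^r a_2=\phi^{-1}(\phi(a)\cup\phi(a_2))$ and $a\wedge^r a_2=\phi^{-1}(\phi(a)\cap\phi(a_2))$, the set $P(S)$ is a Boolean algebra; its smallest element is $\emptyset=\phi^{-1}(\emptyset)$ and its largest element is $\phi^{-1}(C)$. 3. The map $\phi$ is an isomorphism from this Boolean algebra onto the Boolean algebra $(P(C),\cup,\cap)$: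 for all $a,a_2\in P(S)$, $\phi(a\vee^r a_2)=\phi(a)\cup\phi(a_2)$, $\phi(a\wedge^r a_2)=\phi(a)\cap\phi(a_2)$, and $\phi(a')=C\setminus\phi(a)$, where $a'$ is the complement of $a$ in $P(S)$ with respect to $\vee^r,\wedge^r$. 4. For the order $\preceq^r$ of this Boolean algebra, $a\preceq^r a_2$ if and only if $\phi(a)\subseteq\phi(a_2)$, for all $a,a_2\in P(S)$. -/

import Mathlib

open Set Filter Topology

noncomputable section

/-- The two-dimensional sphere, as the unit sphere of Euclidean three-space. -/
abbrev S2 : Type := Metric.sphere (0 : EuclideanSpace ℝ (Fin 3)) 1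

/-- A knot projection: a closed curve on the sphere all of whose multiple points are transverse
double points (finitely many).

No differentiability is assumed.  That the curve is an honest arc near a simple point, and that
the two arcs through a double point cross transversely, is expressed by local coordinates of the
sphere in which the image of the curve is a coordinate axis, respectively the union of the two
coordinate axes with one of the two arcs running along each axis.  Smooth immersed and polygonal
curves with finitely many transverse double points are covered.  Every such curve is the image of
a knot in `S² × ℝ ⊆ S³` under the projection to `S²`. -/
structure KnotProjection where
  /-- the parametrization of the curve by the circle `ℝ / ℤ` -/
  curve : AddCircle (1 : ℝ) → S2
  continuous_curve : Continuous curve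
  finite_double : {x : S2 | ∃ s t, s ≠ t ∧ curve s = x ∧ curve t = x}.Finite
  /-- around a point that is passed only once, the image of the curve is a flat arc -/
  simple_point : ∀ s, (∀ t, curve t = curve s → t = s) →
    ∃ e : OpenPartialHomeomorph S2 (ℝ × ℝ),
      curve s ∈ e.source ∧ e (curve s) = (0, 0) ∧
      ∀ x ∈ e.source, x ∈ range curve ↔ (e x).2 = 0
  /-- a point that is passed twice is passed exactly twice, by two arcs crossing transversely -/
  double_point : ∀ s t, s ≠ t → curve s = curve t →
    (∀ u, curve u = curve s → u = s ∨ u = t) ∧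
    ∃ e : OpenPartialHomeomorph S2 (ℝ × ℝ),
      curve s ∈ e.source ∧ e (curve s) = (0, 0) ∧
      (∀ x ∈ e.source, x ∈ range curve ↔ (e x).1 = 0 ∨ (e x).2 = 0) ∧
      (∀ᶠ u in 𝓝 s, (e (curve u)).2 = 0) ∧
      (∀ᶠ u in 𝓝 t, (e (curve u)).1 = 0)

namespace KnotProjection

variable (P : KnotProjection)

/-- The image of the curve. -/
def image : Set S2 := range P.curve

/-- The set of crossings: the double points of the curve. -/
def crossings : Set S2 := {x | ∃ s t, s ≠ t ∧ P.curve s = x ∧ P.curve t = x}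

/-- `C`: the type of crossings.  Its power set `P(C)` is `Set P.Crossing`. -/
abbrev Crossing : Type := P.crossings

/-- The set of regions: the connected components of the complement of the curve. -/
def regions : Set (Set S2) := {U | ∃ x ∈ P.imageᶜ, U = connectedComponentIn P.imageᶜ x}

/-- `R`: the type of regions.  Its power set `P(R)` is `Set P.Region`. -/
abbrev Region : Type := P.regions

/-- The set of edges: the connected components of the curve with the crossings removed. -/
def edges : Set (Set S2) :=
  {E | ∃ x ∈ P.image \ P.crossings, E = connectedComponentIn (P.image \ P.crossings) x}

variable {P}

/-- The crossing `x` lies on the boundary of the region `r`. -/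
def Incident (x : P.Crossing) (r : P.Region) : Prop := (x : S2) ∈ frontier (r : Set S2)

/-- Two different regions share an edge if some edge is contained in the boundary of both. -/
def ShareEdge (r r' : P.Region) : Prop :=
  r ≠ r' ∧ ∃ E ∈ P.edges, E ⊆ frontier (r : Set S2) ∧ E ⊆ frontier (r' : Set S2)

/-- A checkerboard coloring: regions sharing an edge have different colors
(`true` is black, `false` is white). -/
def IsCheckerboard (color : P.Region → Bool) : Prop :=
  ∀ r r', ShareEdge r r' → color r ≠ color r'

variable (P) in
/-- A knot projection is irreducible if there are four different regions around every crossing. -/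
def Irreducible : Prop := ∀ x : P.Crossing, {r : P.Region | Incident x r}.ncard = 4

/-- The region crossing change (RCC) on a region `r` changes all crossings on the boundary of `r`.
If `A` is the set of the crossings that differ from those of an initial diagram, then `rcc r A` is
this set after the region crossing change on `r`. -/
def rcc (r : P.Region) (A : Set P.Crossing) : Set P.Crossing := symmDiff A {x | Incident x r}

/-- The effect `φ : P(R) → P(C)` of region crossing changes: the crossings that are changed by RCC
on all regions of `T` are those with an odd number of regions of `T` around them. -/
def effect (T : Set P.Region) : Set P.Crossing := {x | Odd {r ∈ T | Incident x r}.ncard}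

/-- `effect T` is what one obtains by performing RCC on the regions of `T` one after another, in
any order. -/
theorem foldr_rcc_eq_effect (l : List P.Region) (hl : l.Nodup) :
    l.foldr rcc ∅ = effect {r | r ∈ l} := by
  induction l with
  | nil => ext x; simp [effect]
  | cons r l ih =>
    obtain ⟨hr, hl⟩ := List.nodup_cons.1 hl
    ext x
    have hfin : {s : P.Region | s ∈ l ∧ Incident x s}.Finite :=
      (List.finite_toSet l).subset fun s hs => hs.1
    rw [List.foldr_cons, ih hl]
    simp only [rcc, effect, mem_symmDiff, mem_ofPred_eq]
    by_cases hx : Incident x r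
    · have h : {s : P.Region | s ∈ r :: l ∧ Incident x s}
          = insert r {s : P.Region | s ∈ l ∧ Incident x s} := by
        ext s
        simp only [List.mem_cons, mem_ofPred_eq, mem_insert_iff]
        constructor
        · rintro ⟨h1 | h1, h2⟩
          · exact Or.inl h1
          · exact Or.inr ⟨h1, h2⟩
        · rintro (rfl | h1)
          · exact ⟨Or.inl rfl, hx⟩
          · exact ⟨Or.inr h1.1, h1.2⟩
      rw [h, ncard_insert_of_notMem (fun h' => hr h'.1) hfin, Nat.odd_add_one]
      tauto
    · have h : {s : P.Region | s ∈ r :: l ∧ Incident x s}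
          = {s : P.Region | s ∈ l ∧ Incident x s} := by
        ext s
        simp only [List.mem_cons, mem_ofPred_eq]
        constructor
        · rintro ⟨rfl | h1, h2⟩
          · exact absurd h2 hx
          · exact ⟨h1, h2⟩
        · exact fun h1 => ⟨Or.inr h1.1, h1.2⟩
      rw [h]
      tauto

/-- The power set `P(S)` of a set `S` of regions.  It is a new type, so that it does not come with
the Boolean algebra structure given by union and intersection. -/
@[ext]
structure SubsetOf (S : Set P.Region) where
  /-- the underlying set of regions -/
  carrier : Set P.Region
  subset : carrier ⊆ S

/-- The restriction `φ : P(S) → P(C)` of the effect map. -/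
def phi (S : Set P.Region) (a : SubsetOf S) : Set P.Crossing := effect a.carrier

end KnotProjection

end

noncomputable section

/-! ### Gluing on intervals, rectangles and the sphere -/

/-! Sets of regions are read as functions `F` from the regions to `ZMod 2`. The crossings changed by
RCC are then those where `crossingSum F`, the sum over the four surrounding regions, equals 1
(`mem_effect_iff`). The main tool is the jump of `F` across the curve at a simple point. At a
crossing, the four-term sum is the sum of the jumps across the two opposite halves of one branch
(`exists_crossing_values`), so it measures how the jump changes when the crossing is passed straight
on.

Injectivity: if all crossing sums vanish, the jump never changes along the curve, which is a single
closed curve; so it is constant (`exists_constant_jump`). If it is 0, `F` is constant on the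
connected sphere. If it is 1, the checkerboard function `black color` has the same jumps, so `F +
black color` is constant. A function vanishing at both `b` and `w` must then be 0
(`eq_zero_of_crossingSum_eq_zero`).

Surjectivity: a crossing `c` cuts the curve into two loops. A function that jumps by 1 exactly
across one loop has crossing sum 1 at `c`, where the loop turns off, and 0 elsewhere
(`exists_crossingSum_eq_single`). Such a function exists because local solutions glue over the
sphere (`exists_hasJumpsOn_univ`); this is the vanishing of the first cohomology of the sphere
modulo 2. Sums give every set of crossings. Black and white indicator functions have zero crossing
sums, and adding them makes the solution vanish at `b` and `w`.

The Boolean algebra is transported along the resulting bijection. No count of the regions is needed.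
-/

/-- If the conclusion fails, the right ends reachable from `A` have a supremum, and the local
hypothesis there reaches beyond it. -/
theorem interval_gluing {T : ℝ → ℝ → Prop}
    (mono : ∀ a b a' b', a ≤ a' → b' ≤ b → T a b → T a' b')
    (glue : ∀ a b c d, a ≤ c → c < b → b ≤ d → T a b → T c d → T a d)
    (loc : ∀ x, ∃ ε > 0, T (x - ε) (x + ε)) (A B : ℝ) : T A B := by
  by_contra hAB
  set s := {x | T A x} with hs
  have hB : ∀ x ∈ s, x ≤ B := fun x hx => by
    by_contra h
    exact hAB (mono _ _ _ _ le_rfl (not_le.1 h).le hx)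
  have hA : A ∈ s := by
    obtain ⟨ε, hε, h⟩ := loc A
    exact mono _ _ _ _ (by linarith) (by linarith) h
  have hbdd : BddAbove s := ⟨B, hB⟩
  obtain ⟨ε, hε, h⟩ := loc (sSup s)
  obtain ⟨x, hx, hxs⟩ := exists_lt_of_lt_csSup ⟨A, hA⟩ (sub_lt_self (sSup s) hε)
  have key : sSup s + ε ∈ s := by
    rcases le_total A (sSup s - ε) with h1 | h1
    · exact glue _ _ _ _ h1 hxs (by linarith [le_csSup hbdd hx]) hx h
    · exact mono _ _ _ _ h1 le_rfl h
  linarith [le_csSup hbdd key]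

/-- Two open rectangles meet in a convex set, so gluing always applies to them. Small squares are
joined into thin horizontal strips, and strips into rectangles. -/
theorem rectangle_gluing {T : Set (ℝ × ℝ) → Prop}
    (mono : ∀ U V, U ⊆ V → T V → T U)
    (glue : ∀ U V, IsOpen U → IsOpen V → IsPreconnected (U ∩ V) → T U → T V → T (U ∪ V))
    (loc : ∀ x, ∃ U ∈ 𝓝 x, T U) (a b c d : ℝ) : T (Ioo a b ×ˢ Ioo c d) := by
  have hglue : ∀ a b c d a' b' c' d',
      T (Ioo a b ×ˢ Ioo c d) → T (Ioo a' b' ×ˢ Ioo c' d') →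
      T (Ioo a b ×ˢ Ioo c d ∪ Ioo a' b' ×ˢ Ioo c' d') := fun a b c d a' b' c' d' h h' => by
    refine glue _ _ (isOpen_Ioo.prod isOpen_Ioo) (isOpen_Ioo.prod isOpen_Ioo) ?_ h h'
    exact (((convex_Ioo a b).prod (convex_Ioo c d)).inter
      ((convex_Ioo a' b').prod (convex_Ioo c' d'))).isPreconnected
  refine interval_gluing (T := fun c d => T (Ioo a b ×ˢ Ioo c d)) ?_ ?_ ?_ c d
  · exact fun _ _ _ _ h1 h2 => mono _ _ (prod_mono le_rfl (Ioo_subset_Ioo h1 h2))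
  · intro p q r s h1 h2 h3 h h'
    refine mono _ _ ?_ (hglue _ _ _ _ _ _ _ _ h h')
    rintro ⟨x, y⟩ ⟨hx, hy⟩
    rcases lt_or_ge y q with hq | hq
    · exact Or.inl ⟨hx, hy.1, hq⟩
    · exact Or.inr ⟨hx, h2.trans_le hq, hy.2⟩
  · intro y
    -- The height of the strip is left existential, since it shrinks to the minimum at each gluing.
    refine interval_gluing (T := fun a b => ∃ ε > 0, T (Ioo a b ×ˢ Ioo (y - ε) (y + ε)))
      ?_ ?_ ?_ a b
    · rintro a b a' b' h1 h2 ⟨ε, hε, h⟩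
      exact ⟨ε, hε, mono _ _ (prod_mono (Ioo_subset_Ioo h1 h2) le_rfl) h⟩
    · rintro p q r s h1 h2 h3 ⟨ε, hε, h⟩ ⟨δ, hδ, h'⟩
      refine ⟨min ε δ, lt_min hε hδ, mono _ _ ?_ (hglue _ _ _ _ _ _ _ _ h h')⟩
      rintro ⟨x, z⟩ ⟨hx, hz⟩
      have h4 := min_le_left ε δ
      have h5 := min_le_right ε δ
      simp only [mem_Ioo] at hx hz
      rcases lt_or_ge x q with hq | hq
      · exact Or.inl ⟨⟨hx.1, hq⟩, by constructor <;> dsimp only <;> linarith⟩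
      · exact Or.inr ⟨⟨h2.trans_le hq, hx.2⟩, by constructor <;> dsimp only <;> linarith⟩
    · intro x
      obtain ⟨U, hU, hT⟩ := loc (x, y)
      obtain ⟨ε, hε, hsub⟩ := Metric.mem_nhds_iff.1 hU
      refine ⟨ε, hε, ε, hε, mono _ _ ?_ hT⟩
      rw [← Real.ball_eq_Ioo, ← Real.ball_eq_Ioo, ball_prod_same]
      exact hsub

theorem isPreconnected_annulus {E : Type*} [NormedAddCommGroup E] [NormedSpace ℝ E]
    (h : 1 < Module.rank ℝ E) {r R : ℝ} (hr : 0 ≤ r) :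
    IsPreconnected {x : E | r < ‖x‖ ∧ ‖x‖ < R} := by
  have : {x : E | r < ‖x‖ ∧ ‖x‖ < R}
      = (fun p : ℝ × E => p.1 • p.2) '' (Ioo r R ×ˢ Metric.sphere 0 1) := by
    ext x
    constructor
    · rintro ⟨h1, h2⟩
      have hx : ‖x‖ ≠ 0 := (hr.trans_lt h1).ne'
      refine ⟨(‖x‖, ‖x‖⁻¹ • x), ⟨⟨h1, h2⟩, ?_⟩, ?_⟩
      · simp [norm_smul, hx]
      · simp [smul_smul, hx]
    · rintro ⟨⟨t, y⟩, ⟨⟨h1, h2⟩, h3⟩, rfl⟩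
      have h3 : ‖y‖ = 1 := by simpa using h3
      have : ‖t • y‖ = t := by
        rw [norm_smul, h3, mul_one, Real.norm_of_nonneg (hr.trans h1.le)]
      simp only [mem_ofPred_eq, this]
      exact ⟨h1, h2⟩
  rw [this]
  refine (isPreconnected_Ioo.prod (isPreconnected_sphere h 0 1)).image _ ?_
  fun_prop

/-! ### Topology of the sphere -/

theorem fact_finrank_three : Fact (Module.finrank ℝ (EuclideanSpace ℝ (Fin 3)) = 2 + 1) :=
  ⟨by simp⟩

instance : LocallyConnectedSpace S2 :=
  have := fact_finrank_three
  ChartedSpace.locallyConnectedSpace (EuclideanSpace ℝ (Fin 2)) S2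

instance : ConnectedSpace S2 := by
  have h : IsConnected (Metric.sphere (0 : EuclideanSpace ℝ (Fin 3)) 1) := by
    refine isConnected_sphere ?_ 0 zero_le_one
    rw [← Module.finrank_eq_rank, finrank_euclideanSpace_fin]
    norm_num
  exact isConnected_iff_connectedSpace.1 h

theorem exists_plane_chart (N : S2) :
    ∃ e : OpenPartialHomeomorph S2 (ℝ × ℝ), e.source = {N}ᶜ ∧ e.target = univ := by
  have := fact_finrank_three
  have hE : Module.finrank ℝ (EuclideanSpace ℝ (Fin 2)) = Module.finrank ℝ (ℝ × ℝ) := by simp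
  refine ⟨(stereographic' 2 N).transHomeomorph
    (ContinuousLinearEquiv.ofFinrankEq hE).toHomeomorph, ?_, ?_⟩
  · simp
  · simp

/-- The sphere without `N` is a plane. A large ball in it and a small neighbourhood of `N` cover the
sphere and overlap in an annulus, which is connected, so one more gluing suffices. -/
theorem sphere_gluing {T : Set S2 → Prop}
    (mono : ∀ U V, U ⊆ V → T V → T U)
    (glue : ∀ U V, IsOpen U → IsOpen V → IsPreconnected (U ∩ V) → T U → T V → T (U ∪ V))
    (loc : ∀ x, ∃ U ∈ 𝓝 x, T U) : T univ := by
  obtain ⟨N⟩ : Nonempty S2 := inferInstance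
  obtain ⟨e, hsource, htarget⟩ := exists_plane_chart N
  have hcont : Continuous e.symm := by
    have := e.continuousOn_symm
    rwa [htarget, continuousOn_univ] at this
  have hopen : ∀ U : Set (ℝ × ℝ), IsOpen U → IsOpen (e.symm '' U) := fun U hU =>
    e.isOpen_image_symm_of_subset_target hU (by simp [htarget])
  have hinj : Function.Injective e.symm := by
    have := e.symm.injOn
    rwa [e.symm_source, htarget, injOn_univ] at this
  have hplane : ∀ a b c d : ℝ, T (e.symm '' (Ioo a b ×ˢ Ioo c d)) := by
    refine rectangle_gluing (T := fun Q => T (e.symm '' Q)) ?_ ?_ ?_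
    · exact fun U V h => mono _ _ (image_mono h)
    · intro U V hU hV hUV h h'
      rw [image_union]
      refine glue _ _ (hopen U hU) (hopen V hV) ?_ h h'
      rw [← image_inter hinj]
      exact hUV.image _ hcont.continuousOn
    · intro x
      obtain ⟨U, hU, h⟩ := loc (e.symm x)
      exact ⟨e.symm ⁻¹' U, hcont.continuousAt hU, mono _ _ (image_preimage_subset _ _) h⟩
  obtain ⟨W', hW', hT'⟩ := loc N
  obtain ⟨W, hWW', hWo, hNW⟩ := mem_nhds_iff.1 hW'
  have hcomp : IsCompact (e '' Wᶜ) := by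
    refine hWo.isClosed_compl.isCompact.image_of_continuousOn (e.continuousOn.mono ?_)
    rw [hsource, compl_subset_compl]
    simpa using hNW
  obtain ⟨R, hR⟩ := hcomp.isBounded.exists_norm_le
  -- The bound `R` may be negative if the neighbourhood of `N` is everything; the annulus needs a
  -- nonnegative inner radius.
  set r := max R 0
  have hr : 0 ≤ r := le_max_right _ _
  have hclosed : IsClosed (e.symm '' Metric.closedBall 0 r) :=
    ((isCompact_closedBall _ _).image hcont).isClosed
  have hV : (e.symm '' Metric.closedBall 0 r)ᶜ ⊆ W := by
    intro x hx
    by_contra hxW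
    refine hx ⟨e x, ?_, e.left_inv ?_⟩
    · exact mem_closedBall_zero_iff.2 ((hR _ ⟨x, hxW, rfl⟩).trans (le_max_left R 0))
    · rw [hsource]
      rintro rfl
      exact hxW hNW
  -- Balls of `ℝ × ℝ` in the sup norm are open squares, so the rectangle case applies.
  have hball : T (e.symm '' Metric.ball 0 (r + 1)) := by
    have := hplane (0 - (r + 1)) (0 + (r + 1)) (0 - (r + 1)) (0 + (r + 1))
    rwa [← Real.ball_eq_Ioo, ball_prod_same] at this
  have := glue _ _ (hopen _ Metric.isOpen_ball) hclosed.isOpen_compl ?_ hball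
    (mono _ _ (hV.trans hWW') hT')
  · convert this
    symm
    refine eq_univ_of_forall fun x => ?_
    by_cases hx : x ∈ e.symm '' Metric.closedBall 0 r
    · exact Or.inl (image_mono (Metric.closedBall_subset_ball (by linarith)) hx)
    · exact Or.inr hx
  · have hrank : 1 < Module.rank ℝ (ℝ × ℝ) := by
      rw [← Module.finrank_eq_rank]
      simp
    convert (isPreconnected_annulus (R := r + 1) hrank hr).image e.symm hcont.continuousOn
      using 1
    ext x
    constructor
    · rintro ⟨⟨y, hy, rfl⟩, h2⟩
      refine ⟨y, ⟨?_, by simpa using hy⟩, rfl⟩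
      by_contra h
      exact h2 ⟨y, by simpa using h, rfl⟩
    · rintro ⟨y, ⟨h1, h2⟩, rfl⟩
      refine ⟨⟨y, by simpa using h2, rfl⟩, ?_⟩
      rintro ⟨z, hz, hzy⟩
      rw [hinj hzy] at hz
      have : ‖y‖ ≤ r := by simpa using hz
      linarith

theorem IsPreconnected.constant_of_eventually {X α : Type*} [TopologicalSpace X] {s : Set X}
    (hs : IsPreconnected s) {f : X → α} (hf : ∀ x ∈ s, ∀ᶠ y in 𝓝[s] x, f y = f x)
    {x y : X} (hx : x ∈ s) (hy : y ∈ s) : f x = f y := by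
  let : TopologicalSpace α := ⊥
  have : DiscreteTopology α := ⟨rfl⟩
  refine hs.constant (f := f) (fun z hz => ?_) hx hy
  rw [ContinuousWithinAt, nhds_discrete, tendsto_pure]
  exact hf z hz

/-! ### Flat points and crossings of a subset of a surface -/

section Local

variable {X α β : Type*} [TopologicalSpace X] {K : Set X} {e : OpenPartialHomeomorph X (ℝ × ℝ)}
  {x y : X}

/-- The sign of a real number that is not zero. -/
def isPos (t : ℝ) : Bool := decide (0 < t)

/-- The side of zero which consists of the numbers of the given sign. -/
def side (s : Bool) : Set ℝ := {t | t ≠ 0 ∧ isPos t = s}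

theorem convex_side (s : Bool) : Convex ℝ (side s) := by
  cases s
  · have : side false = Iio (0 : ℝ) := by
      ext t
      simp only [side, isPos, mem_ofPred_eq, mem_Iio, decide_eq_false_iff_not, not_lt]
      exact ⟨fun h => lt_of_le_of_ne h.2 h.1, fun h => ⟨h.ne, h.le⟩⟩
    exact this ▸ convex_Iio 0
  · have : side true = Ioi (0 : ℝ) := by
      ext t
      simp only [side, isPos, mem_ofPred_eq, mem_Ioi, decide_eq_true_eq]
      exact ⟨fun h => h.2, fun h => ⟨h.ne', h⟩⟩
    exact this ▸ convex_Ioi 0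

theorem eventually_isPos_eq {t : ℝ} (ht : t ≠ 0) : ∀ᶠ u in 𝓝 t, u ≠ 0 ∧ isPos u = isPos t := by
  rcases ht.lt_or_gt with h | h
  · filter_upwards [eventually_lt_nhds h] with u hu
    exact ⟨hu.ne, by simp [isPos, hu.not_gt, h.not_gt]⟩
  · filter_upwards [eventually_gt_nhds h] with u hu
    exact ⟨hu.ne', by simp [isPos, hu, h]⟩

/-- A representative of each sign. -/
def unitOf (s : Bool) : ℝ := if s then 1 else -1

theorem smul_unitOf_mem_side (s : Bool) {t : ℝ} (ht : 0 < t) : t * unitOf s ∈ side s := by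
  cases s
  · simp [side, unitOf, isPos, ht.ne', ht.le]
  · simp [side, unitOf, isPos, ht.ne', ht]

/-- Near `y`, the set `K` is the first coordinate axis of the chart `e`, up to translation. -/
structure FlatAt (K : Set X) (e : OpenPartialHomeomorph X (ℝ × ℝ)) (y : X) : Prop where
  mem_source : y ∈ e.source
  snd_eq : (e y).2 = 0
  mem_iff : ∀ᶠ x in 𝓝 y, x ∈ K ↔ (e x).2 = 0

/-- Near `y`, the set `K` is the union of the coordinate axes of the chart `e`. -/
structure CrossAt (K : Set X) (e : OpenPartialHomeomorph X (ℝ × ℝ)) (y : X) : Prop where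
  mem_source : y ∈ e.source
  eq_zero : e y = (0, 0)
  mem_iff : ∀ᶠ x in 𝓝 y, x ∈ K ↔ (e x).1 = 0 ∨ (e x).2 = 0

/-- `f` is locally constant at `x` unless `x` is in `K`. -/
def LocConstOff (K : Set X) (f : X → α) (x : X) : Prop := x ∉ K → ∀ᶠ y in 𝓝 x, f y = f x

theorem tendsto_chart (hy : y ∈ e.source) : Tendsto e (𝓝 y) (𝓝 (e y)) := e.continuousAt hy

theorem tendsto_chart_fst (hy : y ∈ e.source) :
    Tendsto (fun x => (e x).1) (𝓝 y) (𝓝 (e y).1) :=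
  (continuous_fst.tendsto _).comp (tendsto_chart hy)

theorem tendsto_chart_snd (hy : y ∈ e.source) :
    Tendsto (fun x => (e x).2) (𝓝 y) (𝓝 (e y).2) :=
  (continuous_snd.tendsto _).comp (tendsto_chart hy)

theorem frequently_chart (hy : y ∈ e.source) {p : ℝ × ℝ → Prop}
    (h : ∃ᶠ z in 𝓝 (e y), p z) : ∃ᶠ x in 𝓝 y, p (e x) := by
  have h1 : Tendsto e.symm (𝓝 (e y)) (𝓝 y) := by
    have := e.symm.continuousAt (x := e y) (by simpa using e.map_source hy)
    rwa [ContinuousAt, e.left_inv hy] at this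
  refine h1.frequently ((h.and_eventually (e.eventually_right_inverse' hy)).mono ?_)
  rintro z ⟨hz, hz'⟩
  rwa [hz']

theorem frequently_ray (c d : ℝ × ℝ) {p : ℝ × ℝ → Prop} (h : ∀ t : ℝ, 0 < t → p (c + t • d)) :
    ∃ᶠ z in 𝓝 c, p z := by
  have h1 : Tendsto (fun t : ℝ => c + t • d) (𝓝[>] 0) (𝓝 c) := by
    have : Continuous fun t : ℝ => c + t • d := by fun_prop
    simpa using (this.tendsto 0).mono_left nhdsWithin_le_nhds
  refine h1.frequently (Eventually.frequently ?_)
  filter_upwards [self_mem_nhdsWithin] with t ht using h t ht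

/-- Each side accumulates at `y`. This lets values given by eventual statements be read off at an
actual point. -/
theorem FlatAt.frequently_side (h : FlatAt K e y) (s : Bool) :
    ∃ᶠ x in 𝓝 y, x ∉ K ∧ isPos (e x).2 = s := by
  refine ((frequently_chart h.mem_source (p := fun z => z.2 ∈ side s)
    (frequently_ray _ (0, unitOf s) fun t ht => ?_)).and_eventually h.mem_iff).mono ?_
  · simpa [h.snd_eq] using smul_unitOf_mem_side s ht
  · rintro x ⟨hx, hx'⟩
    exact ⟨fun hK => hx.1 (hx'.1 hK), hx.2⟩

theorem CrossAt.frequently_quadrant (h : CrossAt K e y) (s t : Bool) :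
    ∃ᶠ x in 𝓝 y, x ∉ K ∧ isPos (e x).1 = s ∧ isPos (e x).2 = t := by
  refine ((frequently_chart h.mem_source (p := fun z => z.1 ∈ side s ∧ z.2 ∈ side t)
    (frequently_ray _ (unitOf s, unitOf t) fun r hr => ?_)).and_eventually h.mem_iff).mono ?_
  · simpa [h.eq_zero] using ⟨smul_unitOf_mem_side s hr, smul_unitOf_mem_side t hr⟩
  · rintro x ⟨hx, hx'⟩
    exact ⟨fun hK => (hx'.1 hK).elim hx.1.1 hx.2.1, hx.1.2, hx.2.2⟩

theorem CrossAt.frequently_halfAxis (h : CrossAt K e y) (s : Bool) :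
    ∃ᶠ x in 𝓝 y, (e x).2 = 0 ∧ (e x).1 ≠ 0 ∧ isPos (e x).1 = s := by
  refine (frequently_chart h.mem_source (p := fun z => z.2 = 0 ∧ z.1 ∈ side s)
    (frequently_ray _ (unitOf s, 0) fun r hr => ?_)).mono fun x hx => hx
  simpa [h.eq_zero] using smul_unitOf_mem_side s hr

/-- The chart with the two coordinates exchanged. -/
def swapChart (e : OpenPartialHomeomorph X (ℝ × ℝ)) : OpenPartialHomeomorph X (ℝ × ℝ) :=
  e.transHomeomorph (Homeomorph.prodComm ℝ ℝ)

@[simp] theorem swapChart_apply (x : X) : swapChart e x = ((e x).2, (e x).1) := rfl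

theorem CrossAt.swap (h : CrossAt K e y) : CrossAt K (swapChart e) y where
  mem_source := h.mem_source
  eq_zero := by simp [h.eq_zero]
  mem_iff := h.mem_iff.mono fun x hx => by rw [hx, swapChart_apply, or_comm]

theorem CrossAt.mem (h : CrossAt K e y) : y ∈ K := h.mem_iff.self_of_nhds.2 (by simp [h.eq_zero])

theorem FlatAt.mem (h : FlatAt K e y) : y ∈ K := h.mem_iff.self_of_nhds.2 h.snd_eq

theorem FlatAt.eventually (h : FlatAt K e y) : ∀ᶠ x in 𝓝 y, x ∈ K → FlatAt K e x := by
  filter_upwards [h.mem_iff.eventually_nhds, e.open_source.mem_nhds h.mem_source] with x hx hx' hK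
  exact ⟨hx', hx.self_of_nhds.1 hK, hx⟩

theorem CrossAt.eventually_flatAt (h : CrossAt K e y) :
    ∀ᶠ x in 𝓝 y, (e x).2 = 0 → (e x).1 ≠ 0 → FlatAt K e x := by
  filter_upwards [h.mem_iff.eventually_nhds, e.open_source.mem_nhds h.mem_source]
    with x hx hx' h2 h1
  refine ⟨hx', h2, ?_⟩
  filter_upwards [hx, (tendsto_chart_fst hx').eventually (eventually_isPos_eq h1)] with z hz hz'
  rw [hz]
  exact or_iff_right hz'.1

/-! ### Values on the sectors around a point -/

/-- In the chart, a sector meets a small ball in a convex set, and a locally constant function is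
constant on it. -/
theorem exists_sector_values (hy : y ∈ e.source) {N : Set (ℝ × ℝ)} {σ : ℝ × ℝ → β}
    (hN : ∀ᶠ x in 𝓝 y, x ∈ K ↔ e x ∈ N) (hσ : ∀ b, Convex ℝ (Nᶜ ∩ σ ⁻¹' {b})) {f : X → α}
    (hf : ∀ᶠ x in 𝓝 y, LocConstOff K f x) :
    ∃ v : β → α, ∀ᶠ x in 𝓝 y, x ∉ K → f x = v (σ (e x)) := by
  classical
  have h1 : Tendsto e.symm (𝓝 (e y)) (𝓝 y) := by
    have := e.symm.continuousAt (x := e y) (by simpa using e.map_source hy)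
    rwa [ContinuousAt, e.left_inv hy] at this
  obtain ⟨ε, hε, hball⟩ := Metric.eventually_nhds_iff_ball.1 ((h1.eventually (hN.and hf)).and
    ((e.eventually_right_inverse' hy).and
      (e.open_target.mem_nhds (e.map_source hy))))
  have key : ∀ b, ∃ a, ∀ z ∈ Metric.ball (e y) ε ∩ (Nᶜ ∩ σ ⁻¹' {b}), f (e.symm z) = a := by
    intro b
    by_cases hne : (Metric.ball (e y) ε ∩ (Nᶜ ∩ σ ⁻¹' {b})).Nonempty
    · obtain ⟨w, hw⟩ := hne
      refine ⟨f (e.symm w), fun z hz => ?_⟩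
      refine ((convex_ball (e y) ε).inter (hσ b)).isPreconnected.constant_of_eventually
        (f := fun z => f (e.symm z)) ?_ hz hw
      intro u hu
      obtain ⟨⟨hu1, hu2⟩, hu3, hu4⟩ := hball u hu.1
      rw [hu3] at hu1
      exact nhdsWithin_le_nhds ((e.symm.continuousAt hu4).eventually
        (hu2 fun hK => hu.2.1 (hu1.1 hK)))
    · exact ⟨f y, fun z hz => absurd ⟨z, hz⟩ hne⟩
  choose v hv using key
  refine ⟨v, ?_⟩
  filter_upwards [hN, (tendsto_chart hy).eventually (Metric.ball_mem_nhds _ hε),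
    e.eventually_left_inverse hy] with x hx1 hx2 hx3 hxK
  have := hv (σ (e x)) (e x) ⟨hx2, fun h => hxK (hx1.2 h), rfl⟩
  rwa [hx3] at this

theorem FlatAt.exists_values (h : FlatAt K e y) {f : X → α}
    (hf : ∀ᶠ x in 𝓝 y, LocConstOff K f x) :
    ∃ v : Bool → α, ∀ᶠ x in 𝓝 y, x ∉ K → f x = v (isPos (e x).2) := by
  refine exists_sector_values (N := {z | z.2 = 0}) (σ := fun z => isPos z.2) h.mem_source
    h.mem_iff (fun b => ?_) hf
  convert (convex_univ (𝕜 := ℝ) (E := ℝ)).prod (convex_side b) using 1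
  ext z
  simp [side]

theorem CrossAt.exists_values (h : CrossAt K e y) {f : X → α}
    (hf : ∀ᶠ x in 𝓝 y, LocConstOff K f x) :
    ∃ v : Bool → Bool → α, ∀ᶠ x in 𝓝 y, x ∉ K → f x = v (isPos (e x).1) (isPos (e x).2) := by
  have hσ : ∀ b : Bool × Bool, Convex ℝ ({z : ℝ × ℝ | z.1 = 0 ∨ z.2 = 0}ᶜ ∩
      (fun z => (isPos z.1, isPos z.2)) ⁻¹' {b}) := fun b => by
    convert (convex_side b.1).prod (convex_side b.2) using 1
    ext z
    simp [side, Prod.ext_iff]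
    tauto
  obtain ⟨v, hv⟩ := exists_sector_values h.mem_source h.mem_iff hσ hf
  exact ⟨fun s t => v (s, t), hv⟩

theorem CrossAt.eventually_values (h : CrossAt K e y) {f : X → α} {v : Bool → Bool → α}
    (hv : ∀ᶠ x in 𝓝 y, x ∉ K → f x = v (isPos (e x).1) (isPos (e x).2)) :
    ∀ᶠ x in 𝓝 y, (e x).1 ≠ 0 →
      ∀ᶠ z in 𝓝 x, z ∉ K → f z = v (isPos (e x).1) (isPos (e z).2) := by
  filter_upwards [hv.eventually_nhds, e.open_source.mem_nhds h.mem_source] with x hx hx' h1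
  filter_upwards [hx, (tendsto_chart_fst hx').eventually (eventually_isPos_eq h1)]
    with z hz hz' hzK
  rw [hz hzK, hz'.2]

/-! ### Jumps of functions across a flat point -/

/-- Near `y`, the values of `f` on the two sides of `K` differ by `j`. -/
def HasJump (K : Set X) (f : X → ZMod 2) (y : X) (j : ZMod 2) : Prop :=
  ∃ e, FlatAt K e y ∧ ∃ a, ∀ᶠ x in 𝓝 y, x ∉ K → f x = a + if isPos (e x).2 then j else 0

theorem FlatAt.hasJump (h : FlatAt K e y) {f : X → ZMod 2} {v : Bool → ZMod 2}
    (hv : ∀ᶠ x in 𝓝 y, x ∉ K → f x = v (isPos (e x).2)) :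
    HasJump K f y (v true + v false) := by
  refine ⟨e, h, v false, hv.mono fun x hx hxK => ?_⟩
  rw [hx hxK]
  cases isPos (e x).2
  · simp
  · simp only [if_true]
    rw [add_comm, add_assoc, CharTwo.add_self_eq_zero, add_zero]

/-- The sign in `e'` is locally constant off `K`, hence a function of the sign in `e`. It takes both
values, so it is the identity or the exchange of the sides. -/
theorem FlatAt.compare {e' : OpenPartialHomeomorph X (ℝ × ℝ)} (h : FlatAt K e y)
    (h' : FlatAt K e' y) : ∃ s : Bool, ∀ᶠ x in 𝓝 y, x ∉ K →
      isPos (e' x).2 = xor (isPos (e x).2) s := by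
  have hloc : ∀ᶠ x in 𝓝 y, LocConstOff K (fun x => isPos (e' x).2) x := by
    filter_upwards [h'.mem_iff, e'.open_source.mem_nhds h'.mem_source] with x hx hx' hxK
    exact ((tendsto_chart_snd hx').eventually
      (eventually_isPos_eq (fun h0 => hxK (hx.2 h0)))).mono fun z hz => hz.2
  obtain ⟨v, hv⟩ := h.exists_values hloc
  have hne : v true ≠ v false := by
    intro heq
    obtain ⟨x, ⟨hx, hx1⟩, hx2⟩ := ((h'.frequently_side (!v true)).and_eventually hv).exists
    have := hx2 hx
    rw [hx1] at this
    cases h3 : isPos (e x).2 <;> rw [h3] at this <;> simp_all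
  refine ⟨v false, hv.mono fun x hx hxK => ?_⟩
  rw [hx hxK]
  revert hne
  cases isPos (e x).2 <;> cases v true <;> cases v false <;> decide

theorem HasJump.flatAt {f : X → ZMod 2} {j : ZMod 2} (h : HasJump K f y j) :
    ∃ e, FlatAt K e y := ⟨_, h.choose_spec.1⟩

/-- Independence of the chart: exchanging the sides replaces the base value `a` by `a + j` and keeps
`j`, because `j + j = 0`. -/
theorem HasJump.exists_values {f : X → ZMod 2} {j : ZMod 2} (h : HasJump K f y j)
    (he : FlatAt K e y) :
    ∃ a, ∀ᶠ x in 𝓝 y, x ∉ K → f x = a + if isPos (e x).2 then j else 0 := by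
  obtain ⟨e', he', a, ha⟩ := h
  obtain ⟨s, hs⟩ := he.compare he'
  refine ⟨a + if s then j else 0, ?_⟩
  filter_upwards [ha, hs] with x hx hx' hxK
  rw [hx hxK, hx' hxK, add_assoc]
  congr 1
  cases isPos (e x).2 <;> cases s <;> simp [CharTwo.add_self_eq_zero]

theorem HasJump.add {f g : X → ZMod 2} {j k : ZMod 2} (hf : HasJump K f y j)
    (hg : HasJump K g y k) : HasJump K (fun x => f x + g x) y (j + k) := by
  obtain ⟨e, he⟩ := hf.flatAt
  obtain ⟨a, ha⟩ := hf.exists_values he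
  obtain ⟨b, hb⟩ := hg.exists_values he
  refine ⟨e, he, a + b, ?_⟩
  filter_upwards [ha, hb] with x hx hx' hxK
  rw [hx hxK, hx' hxK]
  split_ifs <;> ring

theorem HasJump.congr {f g : X → ZMod 2} {j : ZMod 2} (hf : HasJump K f y j) (c : ZMod 2)
    (hg : ∀ᶠ x in 𝓝 y, x ∉ K → g x = f x + c) : HasJump K g y j := by
  obtain ⟨e, he, a, ha⟩ := hf
  refine ⟨e, he, a + c, ?_⟩
  filter_upwards [ha, hg] with x hx hx' hxK
  rw [hx' hxK, hx hxK]
  ring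

theorem HasJump.unique {f : X → ZMod 2} {j k : ZMod 2} (hj : HasJump K f y j)
    (hk : HasJump K f y k) : j = k := by
  obtain ⟨e, he, a, ha⟩ := hj
  obtain ⟨b, hb⟩ := hk.exists_values he
  have key : ∀ s : Bool, (a + if s then j else 0) = b + if s then k else 0 := by
    intro s
    obtain ⟨x, ⟨hx, hxs⟩, hx1, hx2⟩ := ((he.frequently_side s).and_eventually (ha.and hb)).exists
    rw [← hxs, ← hx1 hx, ← hx2 hx]
  have h1 := key true
  have h0 := key false
  simp only [if_true, Bool.false_eq_true, if_false, add_zero] at h1 h0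
  rw [h0] at h1
  exact add_left_cancel h1

/-- A jump of `0` means that the function is constant near `y`, outside `K`. -/
theorem HasJump.exists_eq {f : X → ZMod 2} (h : HasJump K f y 0) :
    ∃ a, ∀ᶠ x in 𝓝 y, x ∉ K → f x = a := by
  obtain ⟨e, -, a, ha⟩ := h
  exact ⟨a, by simpa using ha⟩

theorem CrossAt.eventually_hasJump (h : CrossAt K e y) {f : X → ZMod 2}
    {v : Bool → Bool → ZMod 2}
    (hv : ∀ᶠ x in 𝓝 y, x ∉ K → f x = v (isPos (e x).1) (isPos (e x).2)) :
    ∀ᶠ x in 𝓝 y, (e x).2 = 0 → (e x).1 ≠ 0 →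
      HasJump K f x (v (isPos (e x).1) true + v (isPos (e x).1) false) := by
  filter_upwards [h.eventually_flatAt, h.eventually_values hv] with x hx hx' h2 h1
  exact (hx h2 h1).hasJump (hx' h1)

theorem CrossAt.eventually_hasJump_swap (h : CrossAt K e y) {f : X → ZMod 2}
    {v : Bool → Bool → ZMod 2}
    (hv : ∀ᶠ x in 𝓝 y, x ∉ K → f x = v (isPos (e x).1) (isPos (e x).2)) :
    ∀ᶠ x in 𝓝 y, (e x).1 = 0 → (e x).2 ≠ 0 →
      HasJump K f x (v true (isPos (e x).2) + v false (isPos (e x).2)) :=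
  h.swap.eventually_hasJump (v := fun s t => v t s) hv

end Local

namespace KnotProjection

variable {P : KnotProjection}

/-! ### The image of the curve near its points -/

theorem isClosed_image : IsClosed P.image := (isCompact_range P.continuous_curve).isClosed

theorem eventually_notMem_crossings (x : S2) : ∀ᶠ y in 𝓝 x, y ≠ x → y ∉ P.crossings := by
  have h : IsClosed (P.crossings \ {x}) := (P.finite_double.subset sdiff_subset).isClosed
  filter_upwards [h.isOpen_compl.mem_nhds (fun hx => hx.2 rfl)] with y hy hyx hyc
  exact hy ⟨hyc, hyx⟩

/-- The curve is a closed map, so a neighbourhood of the fibre over `x` contains the preimage of a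
neighbourhood of `x`. -/
theorem eventually_forall_param {x : S2} {p : AddCircle (1 : ℝ) → Prop}
    (h : ∀ u, P.curve u = x → ∀ᶠ u' in 𝓝 u, p u') :
    ∀ᶠ y in 𝓝 x, ∀ u, P.curve u = y → p u := by
  have h1 : ∀ᶠ u in 𝓝ˢ (P.curve ⁻¹' {x}), p u := eventually_nhdsSet_iff_forall.2 h
  exact eventually_comap.1 (P.continuous_curve.isClosedMap.comap_nhds_le h1)

theorem exists_flatAt {x : S2} (hx : x ∈ P.image) (hxc : x ∉ P.crossings) :
    ∃ e, FlatAt P.image e x := by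
  obtain ⟨s, rfl⟩ := hx
  obtain ⟨e, h1, h2, h3⟩ := P.simple_point s fun t ht => by
    by_contra hne
    exact hxc ⟨t, s, hne, ht, rfl⟩
  refine ⟨e, h1, by rw [h2], ?_⟩
  filter_upwards [e.open_source.mem_nhds h1] with y hy using h3 y hy

/-- A chart at a double point in which the arc at the parameter `s` runs along the first axis
and the arc at the parameter `t` along the second. -/
structure BranchChart (P : KnotProjection) (e : OpenPartialHomeomorph S2 (ℝ × ℝ))
    (s t : AddCircle (1 : ℝ)) : Prop where
  ne : s ≠ t
  eq : P.curve s = P.curve t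
  crossAt : CrossAt P.image e (P.curve s)
  snd_eq : ∀ᶠ u in 𝓝 s, (e (P.curve u)).2 = 0
  fst_eq : ∀ᶠ u in 𝓝 t, (e (P.curve u)).1 = 0

theorem exists_branchChart {s t : AddCircle (1 : ℝ)} (hne : s ≠ t) (heq : P.curve s = P.curve t) :
    ∃ e, BranchChart P e s t := by
  obtain ⟨-, e, h1, h2, h3, h4, h5⟩ := P.double_point s t hne heq
  refine ⟨e, hne, heq, ⟨h1, h2, ?_⟩, h4, h5⟩
  filter_upwards [e.open_source.mem_nhds h1] with y hy using h3 y hy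

theorem BranchChart.swap {e : OpenPartialHomeomorph S2 (ℝ × ℝ)} {s t : AddCircle (1 : ℝ)}
    (h : BranchChart P e s t) : BranchChart P (swapChart e) t s :=
  ⟨h.ne.symm, h.eq.symm, h.eq ▸ h.crossAt.swap, h.fst_eq, h.snd_eq⟩

theorem BranchChart.param_eq {e : OpenPartialHomeomorph S2 (ℝ × ℝ)} {s t : AddCircle (1 : ℝ)}
    (h : BranchChart P e s t) {u : AddCircle (1 : ℝ)} (hu : P.curve u = P.curve s) :
    u = s ∨ u = t :=
  (P.double_point s t h.ne h.eq).1 u hu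

theorem crossing_exists_chart {x : S2} (hx : x ∈ P.crossings) :
    ∃ e s t, BranchChart P e s t ∧ P.curve s = x := by
  obtain ⟨s, t, hne, rfl, h⟩ := hx
  obtain ⟨e, he⟩ := exists_branchChart hne h.symm
  exact ⟨e, s, t, he, rfl⟩

theorem frequently_notMem_image (x : S2) : ∃ᶠ y in 𝓝 x, y ∉ P.image := by
  by_cases hx : x ∈ P.image
  · by_cases hxc : x ∈ P.crossings
    · obtain ⟨e, s, t, he, rfl⟩ := crossing_exists_chart hxc
      exact (he.crossAt.frequently_quadrant true true).mono fun y hy => hy.1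
    · obtain ⟨e, he⟩ := exists_flatAt hx hxc
      exact (he.frequently_side true).mono fun y hy => hy.1
  · have h : ∀ᶠ y in 𝓝 x, y ∉ P.image := isClosed_image.isOpen_compl.mem_nhds hx
    exact h.frequently

/-- Points on the first axis of a branch chart at `s` are passed near the parameter `s` only. -/
theorem BranchChart.eventually_param {e : OpenPartialHomeomorph S2 (ℝ × ℝ)}
    {s t : AddCircle (1 : ℝ)} (h : BranchChart P e s t) {p : AddCircle (1 : ℝ) → Prop}
    (hp : ∀ᶠ u in 𝓝 s, p u) :
    ∀ᶠ y in 𝓝 (P.curve s), (e y).1 ≠ 0 → ∀ u, P.curve u = y → p u := by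
  have : ∀ᶠ y in 𝓝 (P.curve s), ∀ u, P.curve u = y → (p u ∨ (e (P.curve u)).1 = 0) := by
    refine eventually_forall_param fun u hu => ?_
    rcases h.param_eq hu with rfl | rfl
    · exact hp.mono fun u hu => Or.inl hu
    · exact h.fst_eq.mono fun u hu => Or.inr hu
  filter_upwards [this] with y hy h1 u hu
  refine (hy u hu).resolve_right ?_
  rwa [hu]

/-! ### Functions with prescribed jumps -/

/-- On `U`, the function `f` is locally constant outside the curve, and `j` describes its jumps
across the curve. -/
def HasJumpsOn (P : KnotProjection) (j : S2 → ZMod 2) (f : S2 → ZMod 2) (U : Set S2) : Prop :=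
  (∀ x ∈ U, LocConstOff P.image f x) ∧
    ∀ x ∈ U, x ∈ P.image → x ∉ P.crossings → HasJump P.image f x (j x)

theorem HasJumpsOn.mono {j f : S2 → ZMod 2} {U V : Set S2} (h : HasJumpsOn P j f V) (hUV : U ⊆ V) :
    HasJumpsOn P j f U :=
  ⟨fun x hx => h.1 x (hUV hx), fun x hx => h.2 x (hUV hx)⟩

theorem HasJumpsOn.add {j k f g : S2 → ZMod 2} {U : Set S2} (hf : HasJumpsOn P j f U)
    (hg : HasJumpsOn P k g U) :
    HasJumpsOn P (fun x => j x + k x) (fun x => f x + g x) U := by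
  refine ⟨fun x hx hxK => ?_, fun x hx hxK hxc => (hf.2 x hx hxK hxc).add (hg.2 x hx hxK hxc)⟩
  filter_upwards [hf.1 x hx hxK, hg.1 x hx hxK] with y hy hy'
  rw [hy, hy']

theorem BranchChart.values_eq {e : OpenPartialHomeomorph S2 (ℝ × ℝ)} {s t : AddCircle (1 : ℝ)}
    (h : BranchChart P e s t) {f : S2 → ZMod 2} {v : Bool → Bool → ZMod 2}
    (hv : ∀ᶠ x in 𝓝 (P.curve s), x ∉ P.image → f x = v (isPos (e x).1) (isPos (e x).2)) (b : Bool)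
    {d : ZMod 2} (hd : ∀ᶠ y in 𝓝 (P.curve s), (e y).2 = 0 → (e y).1 ≠ 0 → isPos (e y).1 = b →
      HasJump P.image f y d) :
    v b true + v b false = d := by
  obtain ⟨y, ⟨h2, h1, hb⟩, hy, hy'⟩ := ((h.crossAt.frequently_halfAxis b).and_eventually
    ((h.crossAt.eventually_hasJump hv).and hd)).exists
  rw [← hb]
  exact (hy h2 h1).unique (hy' h2 h1 hb)

theorem BranchChart.eventually_simple {e : OpenPartialHomeomorph S2 (ℝ × ℝ)}
    {s t : AddCircle (1 : ℝ)} (h : BranchChart P e s t) :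
    ∀ᶠ y in 𝓝 (P.curve s), (e y).2 = 0 → (e y).1 ≠ 0 → y ∈ P.image ∧ y ∉ P.crossings := by
  filter_upwards [h.crossAt.eventually_flatAt, eventually_notMem_crossings (P := P) (P.curve s)]
    with y hy hy' h2 h1
  refine ⟨(hy h2 h1).mem, hy' ?_⟩
  rintro rfl
  exact h1 (by rw [h.crossAt.eq_zero])

/-- At a crossing, zero jumps across three of the half-axes already identify all four quadrant
values. -/
theorem HasJumpsOn.exists_eq {f : S2 → ZMod 2} {U : Set S2} (hU : IsOpen U)
    (h : HasJumpsOn P (fun _ => 0) f U) {x : S2} (hx : x ∈ U) :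
    ∃ a, ∀ᶠ y in 𝓝 x, y ∉ P.image → f y = a := by
  by_cases hxK : x ∈ P.image
  · by_cases hxc : x ∈ P.crossings
    · obtain ⟨e, s, t, he, rfl⟩ := crossing_exists_chart hxc
      have hU' : ∀ᶠ y in 𝓝 (P.curve s), y ∈ U := hU.mem_nhds hx
      obtain ⟨v, hv⟩ := he.crossAt.exists_values (hU'.mono h.1)
      have h1 : ∀ b, v b true = v b false := fun b => CharTwo.add_eq_zero.1 <| by
        refine he.values_eq hv b ?_
        filter_upwards [hU', he.eventually_simple] with y hyU hy h2 h1 _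
        exact h.2 y hyU (hy h2 h1).1 (hy h2 h1).2
      have h2 : v true true = v false true := CharTwo.add_eq_zero.1 <| by
        have hs := he.swap
        refine hs.values_eq (f := f) (v := fun b c => v c b) (he.eq ▸ hv) true ?_
        rw [← he.eq]
        filter_upwards [hU', he.eq ▸ hs.eventually_simple] with y hyU hy h2 h1 _
        exact h.2 y hyU (hy h2 h1).1 (hy h2 h1).2
      refine ⟨v true true, hv.mono fun y hy hyK => ?_⟩
      rw [hy hyK]
      cases isPos (e y).1 <;> cases isPos (e y).2 <;> simp [← h1, h2]
    · exact (h.2 x hx hxK hxc).exists_eq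
  · exact ⟨f x, (h.1 x hx hxK).mono fun y hy _ => hy⟩

/-- The nearby value `D` extends `f` across the curve. It is locally constant on `U` because the
complement of the curve is dense. -/
theorem HasJumpsOn.exists_forall_eq {f : S2 → ZMod 2} {U : Set S2} (hU : IsOpen U)
    (hUp : IsPreconnected U) (h : HasJumpsOn P (fun _ => 0) f U) :
    ∃ a, ∀ x ∈ U, x ∉ P.image → f x = a := by
  classical
  have h' : ∀ x, ∃ a, x ∈ U → ∀ᶠ y in 𝓝 x, y ∉ P.image → f y = a := fun x => by
    by_cases hx : x ∈ U
    · exact (h.exists_eq hU hx).imp fun a ha _ => ha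
    · exact ⟨0, fun hx' => absurd hx' hx⟩
  choose D hD using h'
  have hfD : ∀ x ∈ U, x ∉ P.image → f x = D x := fun x hx hxK => (hD x hx).self_of_nhds hxK
  rcases U.eq_empty_or_nonempty with rfl | ⟨x₀, hx₀⟩
  · exact ⟨0, fun x hx => absurd hx (notMem_empty x)⟩
  refine ⟨D x₀, fun x hx hxK => ?_⟩
  rw [hfD x hx hxK]
  refine hUp.constant_of_eventually (f := D) (fun z hz => nhdsWithin_le_nhds ?_) hx hx₀
  filter_upwards [(hD z hz).eventually_nhds, hU.mem_nhds hz] with y hy hyU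
  obtain ⟨w, hwK, hw1, hw2⟩ :=
    ((frequently_notMem_image (P := P) y).and_eventually (hy.and (hD y hyU))).exists
  rw [← hw1 hwK, ← hw2 hwK]

/-- Two solutions with the same jumps have a sum without jumps, which is constant on a connected
overlap. Adding this constant to one of them makes them agree off the curve. -/
theorem exists_hasJumpsOn_univ (j : S2 → ZMod 2)
    (loc : ∀ x, ∃ U ∈ 𝓝 x, ∃ f, HasJumpsOn P j f U) : ∃ f, HasJumpsOn P j f univ := by
  classical
  refine sphere_gluing (T := fun U => ∃ f, HasJumpsOn P j f U) ?_ ?_ loc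
  · rintro U V hUV ⟨f, hf⟩
    exact ⟨f, hf.mono hUV⟩
  · rintro U V hU hV hUV ⟨f, hf⟩ ⟨g, hg⟩
    obtain ⟨a, ha⟩ := HasJumpsOn.exists_forall_eq (P := P) (f := fun x => f x + g x)
      (hU.inter hV) hUV (by
        simpa [CharTwo.add_self_eq_zero] using
          (hf.mono inter_subset_left).add (hg.mono inter_subset_right))
    set h : S2 → ZMod 2 := fun x => if x ∈ U then f x else g x + a
    have hhU : ∀ x ∈ U, ∀ᶠ y in 𝓝 x, h y = f y := fun x hx => by
      filter_upwards [hU.mem_nhds hx] with y hy using if_pos hy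
    have hhV : ∀ x ∈ V, ∀ᶠ y in 𝓝 x, y ∉ P.image → h y = g y + a := fun x hx => by
      filter_upwards [hV.mem_nhds hx] with y hy hyK
      by_cases hyU : y ∈ U
      · rw [← ha y ⟨hyU, hy⟩ hyK]
        simp only [h, if_pos hyU]
        rw [add_comm (f y), ← add_assoc, CharTwo.add_self_eq_zero, zero_add]
      · exact if_neg hyU
    refine ⟨h, fun x hx hxK => ?_, fun x hx hxK hxc => ?_⟩
    · rcases hx with hx | hx
      · filter_upwards [hhU x hx, hf.1 x hx hxK] with y hy hy'
        rw [hy, hy', (hhU x hx).self_of_nhds]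
      · filter_upwards [hhV x hx, hg.1 x hx hxK, isClosed_image.isOpen_compl.mem_nhds hxK]
          with y hy hy' hyK
        rw [hy hyK, hy', (hhV x hx).self_of_nhds hxK]
    · rcases hx with hx | hx
      · refine (hf.2 x hx hxK hxc).congr 0 ((hhU x hx).mono fun y hy _ => ?_)
        rw [hy, add_zero]
      · exact (hg.2 x hx hxK hxc).congr a (hhV x hx)

/-! ### Regions -/

variable (P) in
/-- The region that contains the point `x`. -/
def regionOf (x : S2) : Set S2 := connectedComponentIn P.imageᶜ x

theorem regionOf_mem_regions {x : S2} (hx : x ∉ P.image) : P.regionOf x ∈ P.regions := ⟨x, hx, rfl⟩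

theorem mem_region_iff {r : Set S2} (hr : r ∈ P.regions) {x : S2} :
    x ∈ r ↔ x ∉ P.image ∧ P.regionOf x = r := by
  obtain ⟨y, hy, rfl⟩ := hr
  refine ⟨fun hx => ⟨connectedComponentIn_subset _ _ hx, (connectedComponentIn_eq hx).symm⟩, ?_⟩
  rintro ⟨hx, h⟩
  rw [← h]
  exact mem_connectedComponentIn hx

theorem isOpen_region {r : Set S2} (hr : r ∈ P.regions) : IsOpen r := by
  obtain ⟨y, hy, rfl⟩ := hr
  exact isClosed_image.isOpen_compl.connectedComponentIn

theorem region_exists_mem (r : P.Region) : ∃ x, x ∈ (r : Set S2) := by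
  obtain ⟨r, y, hy, rfl⟩ := r
  exact ⟨y, mem_connectedComponentIn hy⟩

theorem locConstOff_regionOf (x : S2) : LocConstOff P.image P.regionOf x := fun hx => by
  filter_upwards [(isOpen_region (regionOf_mem_regions hx)).mem_nhds
    (mem_connectedComponentIn hx)] with y hy
  exact (connectedComponentIn_eq hy).symm

theorem mem_frontier_region_iff {r : Set S2} (hr : r ∈ P.regions) {x : S2} (hx : x ∈ P.image) :
    x ∈ frontier r ↔ ∃ᶠ y in 𝓝 x, y ∉ P.image ∧ P.regionOf y = r := by
  rw [(isOpen_region hr).frontier_eq, Set.mem_sdiff, mem_closure_iff_frequently]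
  simp only [mem_region_iff hr]
  exact and_iff_left fun h => h.1 hx

open Classical in
/-- The function on the sphere that takes the value `F r` on each region `r`. -/
def onSphere (F : P.Region → ZMod 2) (x : S2) : ZMod 2 :=
  if h : P.regionOf x ∈ P.regions then F ⟨P.regionOf x, h⟩ else 0

theorem onSphere_of_eq (F : P.Region → ZMod 2) {x : S2} {r : P.Region} (h : P.regionOf x = r) :
    onSphere F x = F r := by
  have h' : P.regionOf x ∈ P.regions := h ▸ r.2
  rw [onSphere, dif_pos h']
  exact congrArg F (Subtype.ext h)

theorem onSphere_of_mem (F : P.Region → ZMod 2) {x : S2} {r : P.Region} (h : x ∈ (r : Set S2)) :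
    onSphere F x = F r := onSphere_of_eq F ((mem_region_iff r.2).1 h).2

theorem locConstOff_onSphere (F : P.Region → ZMod 2) (x : S2) :
    LocConstOff P.image (onSphere F) x := fun hx => by
  filter_upwards [locConstOff_regionOf x hx] with y hy
  set r : P.Region := ⟨_, regionOf_mem_regions hx⟩
  rw [onSphere_of_eq F (r := r) hy, onSphere_of_eq F (r := r) rfl]

theorem exists_sides_of_flatAt {e : OpenPartialHomeomorph S2 (ℝ × ℝ)} {y : S2}
    (h : FlatAt P.image e y) : ∃ q : Bool → P.Region,
      ∀ᶠ x in 𝓝 y, x ∉ P.image → P.regionOf x = q (isPos (e x).2) := by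
  obtain ⟨v, hv⟩ := h.exists_values (Eventually.of_forall (locConstOff_regionOf (P := P)))
  have hreg : ∀ b, v b ∈ P.regions := fun b => by
    obtain ⟨x, ⟨hxK, hb⟩, hx⟩ := ((h.frequently_side b).and_eventually hv).exists
    rw [← hb, ← hx hxK]
    exact regionOf_mem_regions hxK
  exact ⟨fun b => ⟨v b, hreg b⟩, hv⟩

theorem mem_frontier_iff_of_flatAt {e : OpenPartialHomeomorph S2 (ℝ × ℝ)} {y : S2}
    (h : FlatAt P.image e y) {q : Bool → P.Region}
    (hq : ∀ᶠ x in 𝓝 y, x ∉ P.image → P.regionOf x = q (isPos (e x).2)) (r : P.Region) :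
    y ∈ frontier (r : Set S2) ↔ ∃ b, q b = r := by
  rw [mem_frontier_region_iff r.2 h.mem]
  constructor
  · intro hf
    obtain ⟨x, ⟨hxK, hxr⟩, hx⟩ := (hf.and_eventually hq).exists
    exact ⟨_, Subtype.ext ((hx hxK).symm.trans hxr)⟩
  · rintro ⟨b, rfl⟩
    refine ((h.frequently_side b).and_eventually hq).mono ?_
    rintro x ⟨⟨hxK, hb⟩, hx⟩
    exact ⟨hxK, by rw [hx hxK, hb]⟩

/-- The regions on the two sides of a simple point of the curve share an edge. -/
theorem shareEdge_of_flatAt {e : OpenPartialHomeomorph S2 (ℝ × ℝ)} {y : S2}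
    (h : FlatAt P.image e y) (hyc : y ∉ P.crossings) {q : Bool → P.Region}
    (hq : ∀ᶠ x in 𝓝 y, x ∉ P.image → P.regionOf x = q (isPos (e x).2))
    (hne : q true ≠ q false) : ShareEdge (q true) (q false) := by
  have hy : y ∈ P.image \ P.crossings := ⟨h.mem, hyc⟩
  -- Near a simple point, the points of the curve border the same two side regions. Bordering a
  -- given region is thus locally constant along the curve without crossings, hence constant on an
  -- edge.
  have key : ∀ b, connectedComponentIn (P.image \ P.crossings) y
      ⊆ frontier (q b : Set S2) := fun b z hz => by
    have := isPreconnected_connectedComponentIn.constant_of_eventually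
      (f := fun z => z ∈ frontier (q b : Set S2)) ?_ (mem_connectedComponentIn hy) hz
    · rw [← this]
      exact (mem_frontier_iff_of_flatAt h hq _).2 ⟨b, rfl⟩
    intro w hw
    obtain ⟨hwK, hwc⟩ := connectedComponentIn_subset _ _ hw
    obtain ⟨e', he'⟩ := exists_flatAt hwK hwc
    obtain ⟨q', hq'⟩ := exists_sides_of_flatAt he'
    filter_upwards [nhdsWithin_le_nhds he'.eventually, nhdsWithin_le_nhds hq'.eventually_nhds,
      self_mem_nhdsWithin] with u hu hu' hu2
    have huK := (connectedComponentIn_subset _ _ hu2).1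
    exact propext ((mem_frontier_iff_of_flatAt (hu huK) hu' _).trans
      (mem_frontier_iff_of_flatAt he' hq' _).symm)
  exact ⟨hne, _, ⟨y, hy, rfl⟩, key true, key false⟩

/-- The indicator function of the black regions. -/
def black (color : P.Region → Bool) (r : P.Region) : ZMod 2 := if color r then 1 else 0

/-- The jump 1 of `F` guarantees that the two sides belong to different regions; only then does the
coloring say anything. -/
theorem hasJump_black {color : P.Region → Bool} (hcolor : IsCheckerboard color) {y : S2}
    (hyK : y ∈ P.image) (hyc : y ∉ P.crossings) {F : P.Region → ZMod 2}
    (hF : HasJump P.image (onSphere F) y 1) : HasJump P.image (onSphere (black color)) y 1 := by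
  obtain ⟨e, he⟩ := exists_flatAt hyK hyc
  obtain ⟨q, hq⟩ := exists_sides_of_flatAt he
  have hG : ∀ G : P.Region → ZMod 2, HasJump P.image (onSphere G) y (G (q true) + G (q false)) :=
    fun G => he.hasJump (v := fun b => G (q b))
      (hq.mono fun x hx hxK => onSphere_of_eq G (hx hxK))
  have hne : q true ≠ q false := fun heq => by
    have := hF.unique (hG F)
    rw [heq, CharTwo.add_self_eq_zero] at this
    exact one_ne_zero this
  have hcol := hcolor _ _ (shareEdge_of_flatAt he hyc hq hne)
  convert hG (black color)
  simp only [black]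
  revert hcol
  cases color (q true) <;> cases color (q false) <;> decide

/-! ### The regions around a crossing -/

theorem exists_quadrants (hP : P.Irreducible) {x : P.Crossing}
    {e : OpenPartialHomeomorph S2 (ℝ × ℝ)} (he : CrossAt P.image e (x : S2)) :
    ∃ q : Bool × Bool → P.Region, Function.Injective q ∧ range q = {r | Incident x r} ∧
      ∀ᶠ y in 𝓝 (x : S2), y ∉ P.image → P.regionOf y = q (isPos (e y).1, isPos (e y).2) := by
  obtain ⟨v, hv⟩ := he.exists_values (Eventually.of_forall (locConstOff_regionOf (P := P)))
  have hreg : ∀ b c, v b c ∈ P.regions := fun b c => by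
    obtain ⟨y, ⟨hyK, hb, hc⟩, hy⟩ := ((he.frequently_quadrant b c).and_eventually hv).exists
    rw [← hb, ← hc, ← hy hyK]
    exact regionOf_mem_regions hyK
  set q : Bool × Bool → P.Region := fun p => ⟨v p.1 p.2, hreg p.1 p.2⟩ with hq
  have hrange : range q = {r | Incident x r} := by
    ext r
    rw [mem_ofPred_eq, Incident, mem_frontier_region_iff r.2 he.mem]
    constructor
    · rintro ⟨⟨b, c⟩, rfl⟩
      refine ((he.frequently_quadrant b c).and_eventually hv).mono ?_
      rintro y ⟨⟨hyK, hb, hc⟩, hy⟩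
      exact ⟨hyK, by rw [hy hyK, hb, hc]⟩
    · intro hf
      obtain ⟨y, ⟨hyK, hyr⟩, hy⟩ := (hf.and_eventually hv).exists
      exact ⟨(isPos (e y).1, isPos (e y).2), Subtype.ext ((hy hyK).symm.trans hyr)⟩
  refine ⟨q, ?_, hrange, hv⟩
  classical
  -- Irreducibility: four quadrants cover four regions, so different quadrants lie in different
  -- regions.
  have hcard : (Finset.univ.image q).card = (Finset.univ : Finset (Bool × Bool)).card := by
    rw [← ncard_coe_finset, Finset.coe_image, Finset.coe_univ, image_univ, hrange, hP x]
    rfl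
  simpa using Finset.card_image_iff.1 hcard

/-- The sum of the values of `F` over the regions around the crossing `x`. -/
def crossingSum (F : P.Region → ZMod 2) (x : P.Crossing) : ZMod 2 :=
  ∑ᶠ r ∈ {r | Incident x r}, F r

theorem finite_incident (hP : P.Irreducible) (x : P.Crossing) :
    {r : P.Region | Incident x r}.Finite :=
  finite_of_ncard_ne_zero (by rw [hP x]; norm_num)

theorem crossingSum_add (hP : P.Irreducible) (F G : P.Region → ZMod 2) (x : P.Crossing) :
    crossingSum (F + G) x = crossingSum F x + crossingSum G x :=
  finsum_mem_add_distrib (finite_incident hP x)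

theorem mem_effect_iff (hP : P.Irreducible) (F : P.Region → ZMod 2) (x : P.Crossing) :
    x ∈ effect {r | F r = 1} ↔ crossingSum F x = 1 := by
  classical
  have hfin := finite_incident hP x
  have h1 : {r | r ∈ {r | F r = 1} ∧ Incident x r}
      = ((hfin.toFinset.filter fun r => F r = 1 : Finset P.Region) : Set P.Region) := by
    ext r
    simp [and_comm]
  have h2 : crossingSum F x
      = ((hfin.toFinset.filter fun r => F r = 1).card : ZMod 2) := by
    rw [crossingSum, finsum_mem_eq_finite_toFinset_sum _ hfin, Finset.card_filter, Nat.cast_sum]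
    refine Finset.sum_congr rfl fun r _ => ?_
    generalize F r = a
    revert a
    decide
  rw [effect, mem_ofPred_eq, h1, ncard_coe_finset, h2, ZMod.natCast_eq_one_iff_odd]

theorem exists_crossing_values (hP : P.Irreducible) {x : P.Crossing}
    {e : OpenPartialHomeomorph S2 (ℝ × ℝ)} (he : CrossAt P.image e (x : S2))
    (F : P.Region → ZMod 2) :
    ∃ v : Bool → Bool → ZMod 2,
      (∀ᶠ y in 𝓝 (x : S2), y ∉ P.image → onSphere F y = v (isPos (e y).1) (isPos (e y).2)) ∧
      crossingSum F x = (v true true + v true false) + (v false true + v false false) := by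
  obtain ⟨q, hinj, hrange, hq⟩ := exists_quadrants hP he
  refine ⟨fun b c => F (q (b, c)), hq.mono fun y hy hyK => onSphere_of_eq F (hy hyK), ?_⟩
  rw [crossingSum, ← hrange, finsum_mem_range hinj, finsum_eq_sum_of_fintype,
    Fintype.sum_prod_type]
  simp

/-! ### Injectivity -/

theorem eventually_coe_ne (u : ℝ) :
    ∀ᶠ u' in 𝓝 u, u' ≠ u → (u' : AddCircle (1 : ℝ)) ≠ (u : AddCircle (1 : ℝ)) := by
  filter_upwards [Ioo_mem_nhds (show u - 1 / 2 < u by linarith) (show u < u + 1 / 2 by linarith)]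
    with u' hu' hne heq
  refine hne ((AddCircle.coe_eq_coe_iff_of_mem_Ico (a := u - 1 / 2) ?_ ?_).1 heq)
  · exact ⟨hu'.1.le, by linarith [hu'.2]⟩
  · constructor <;> linarith

theorem BranchChart.eventually_fst_ne {e : OpenPartialHomeomorph S2 (ℝ × ℝ)}
    {s t : AddCircle (1 : ℝ)} (h : BranchChart P e s t) :
    ∀ᶠ u in 𝓝 s, u ≠ s → (e (P.curve u)).1 ≠ 0 := by
  filter_upwards [h.snd_eq, eventually_ne_nhds h.ne,
    P.continuous_curve.continuousAt.eventually (e.open_source.mem_nhds h.crossAt.mem_source)]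
    with u h2 hut hu hus h1
  refine (h.param_eq (e.injOn hu h.crossAt.mem_source ?_)).elim hus hut
  rw [h.crossAt.eq_zero]
  exact Prod.ext h1 h2

/-- If the sum of `F` around each crossing vanishes, then the jump of `F` is the same on both sides
of a crossing when it is passed straight on. -/
theorem exists_jump_near_param (hP : P.Irreducible) {F : P.Region → ZMod 2}
    (hF : ∀ x, crossingSum F x = 0) (u : ℝ) :
    ∃ d, (P.curve u ∉ P.crossings → HasJump P.image (onSphere F) (P.curve u) d) ∧
      ∀ᶠ u' : ℝ in 𝓝 u, u' ≠ u → HasJump P.image (onSphere F) (P.curve u') d := by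
  have hcont : Continuous fun u : ℝ => P.curve u :=
    P.continuous_curve.comp (AddCircle.continuous_mk' 1)
  have hcoe : Tendsto (fun u : ℝ => (u : AddCircle (1 : ℝ))) (𝓝 u) (𝓝 u) :=
    (AddCircle.continuous_mk' 1).tendsto u
  have hloc := Eventually.of_forall (f := 𝓝 (P.curve u)) (locConstOff_onSphere F)
  by_cases hc : P.curve u ∈ P.crossings
  · obtain ⟨s, t, hne, hs, ht⟩ := hc
    -- Takes `u` itself as the first parameter, so that its branch runs along the first axis.
    obtain ⟨t, hne, ht⟩ : ∃ t, (u : AddCircle (1 : ℝ)) ≠ t ∧ P.curve u = P.curve t := by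
      by_cases h : (u : AddCircle (1 : ℝ)) = s
      · exact ⟨t, h ▸ hne, ht.symm⟩
      · exact ⟨s, h, hs.symm⟩
    obtain ⟨e, he⟩ := exists_branchChart hne ht
    have hx : P.curve u ∈ P.crossings := ⟨_, _, hne, rfl, ht.symm⟩
    obtain ⟨v, hv, hsum⟩ := exists_crossing_values hP (x := ⟨_, hx⟩) he.crossAt F
    rw [hF] at hsum
    have hv' : ∀ b, v b true + v b false = v true true + v true false := by
      rintro (_ | _)
      · exact (CharTwo.add_eq_zero.1 hsum.symm).symm
      · rfl
    refine ⟨v true true + v true false, fun h => absurd hx h, ?_⟩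
    filter_upwards [hcont.continuousAt.eventually (he.crossAt.eventually_hasJump hv),
      hcoe.eventually he.snd_eq, hcoe.eventually he.eventually_fst_ne, eventually_coe_ne u]
      with u' h1 h2 h3 h4 hne'
    rw [← hv' (isPos (e (P.curve u')).1)]
    exact h1 h2 (h3 (h4 hne'))
  · obtain ⟨e, he⟩ := exists_flatAt (P := P) ⟨_, rfl⟩ hc
    obtain ⟨v, hv⟩ := he.exists_values hloc
    have key : ∀ᶠ u' : ℝ in 𝓝 u,
        HasJump P.image (onSphere F) (P.curve u') (v true + v false) := by
      filter_upwards [hcont.continuousAt.eventually (he.eventually.and hv.eventually_nhds)]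
        with u' hu'
      exact (hu'.1 ⟨_, rfl⟩).hasJump hu'.2
    exact ⟨_, fun _ => key.self_of_nhds, key.mono fun u' hu' _ => hu'⟩

/-- The jump near a parameter is locally constant in the parameter: values at two close parameters
are compared at a third one close to both. As the line is connected and covers the curve, it is
constant. -/
theorem exists_constant_jump (hP : P.Irreducible) {F : P.Region → ZMod 2}
    (hF : ∀ x, crossingSum F x = 0) :
    ∃ d, ∀ x ∈ P.image, x ∉ P.crossings → HasJump P.image (onSphere F) x d := by
  choose d hd hd' using exists_jump_near_param hP hF
  refine ⟨d 0, ?_⟩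
  rintro x ⟨u, rfl⟩ hx
  obtain ⟨u, rfl⟩ := QuotientAddGroup.mk_surjective u
  have : d u = d 0 := by
    refine isPreconnected_univ.constant_of_eventually (fun a _ => nhdsWithin_le_nhds ?_)
      (mem_univ u) (mem_univ 0)
    filter_upwards [(hd' a).eventually_nhds] with b hb
    rcases eq_or_ne b a with rfl | hne
    · rfl
    · have h1 : ∀ᶠ c : ℝ in 𝓝[≠] b, HasJump P.image (onSphere F) (P.curve c) (d a) := by
        filter_upwards [nhdsWithin_le_nhds hb,
          nhdsWithin_le_nhds (eventually_ne_nhds hne)] with c hc hca using hc hca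
      have h2 : ∀ᶠ c : ℝ in 𝓝[≠] b, HasJump P.image (onSphere F) (P.curve c) (d b) :=
        eventually_nhdsWithin_iff.2 (hd' b)
      obtain ⟨c, hc1, hc2⟩ := (h1.and h2).exists
      exact hc2.unique hc1
  rw [← this]
  exact hd u hx

theorem exists_forall_region_eq {F : P.Region → ZMod 2}
    (hF : ∀ x ∈ P.image, x ∉ P.crossings → HasJump P.image (onSphere F) x 0) :
    ∃ a, ∀ r, F r = a := by
  obtain ⟨a, ha⟩ := HasJumpsOn.exists_forall_eq (P := P) isOpen_univ isPreconnected_univ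
    ⟨fun x _ => locConstOff_onSphere F x, fun x _ => hF x⟩
  refine ⟨a, fun r => ?_⟩
  obtain ⟨x, hx⟩ := region_exists_mem r
  rw [← ha x (mem_univ x) ((mem_region_iff r.2).1 hx).1, onSphere_of_mem F hx]

theorem onSphere_add (F G : P.Region → ZMod 2) (x : S2) :
    onSphere (F + G) x = onSphere F x + onSphere G x := by
  by_cases h : P.regionOf x ∈ P.regions
  · simp [onSphere, h]
  · simp [onSphere, h]

theorem eq_zero_of_crossingSum_eq_zero (hP : P.Irreducible) {color : P.Region → Bool}
    (hcolor : IsCheckerboard color) {b w : P.Region} (hb : color b = true)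
    (hw : color w = false) {F : P.Region → ZMod 2} (hF : ∀ x, crossingSum F x = 0)
    (hFb : F b = 0) (hFw : F w = 0) : F = 0 := by
  obtain ⟨d, hd⟩ := exists_constant_jump hP hF
  obtain rfl | rfl : d = 0 ∨ d = 1 := (by decide : ∀ d : ZMod 2, d = 0 ∨ d = 1) d
  · obtain ⟨a, ha⟩ := exists_forall_region_eq hd
    funext r
    rw [ha r, ← ha b, hFb, Pi.zero_apply]
  · obtain ⟨a, ha⟩ := exists_forall_region_eq (F := F + black color) fun x hx hxc => by
      have := (hd x hx hxc).add (hasJump_black hcolor hx hxc (hd x hx hxc))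
      rw [CharTwo.add_self_eq_zero] at this
      exact this.congr 0 (Eventually.of_forall fun y _ => by rw [onSphere_add, add_zero])
    have h1 := ha b
    have h2 := ha w
    rw [← h2] at h1
    simp [black, hb, hw, hFb, hFw] at h1

/-- Around each crossing there are two black regions. -/
theorem crossingSum_black (hP : P.Irreducible) {color : P.Region → Bool}
    (hcolor : IsCheckerboard color) (x : P.Crossing) : crossingSum (black color) x = 0 := by
  obtain ⟨e, s, t, he, hx⟩ := crossing_exists_chart x.2
  have hcross : CrossAt P.image e (x : S2) := hx ▸ he.crossAt
  obtain ⟨q, hinj, hrange, hq⟩ := exists_quadrants hP hcross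
  -- Each half of the first axis consists, near the crossing, of simple points separating two
  -- different quadrant regions, which therefore have different colors.
  have key : ∀ c, black color (q (c, true)) + black color (q (c, false)) = 1 := by
    intro c
    obtain ⟨y, ⟨h2, h1, hc⟩, hy1, hy2, hy3⟩ := ((hcross.frequently_halfAxis c).and_eventually
      (hcross.eventually_flatAt.and ((hx ▸ he.eventually_simple).and
        (hcross.eventually_values (v := fun b c => (q (b, c) : Set S2)) hq)))).exists
    have hne : q (c, true) ≠ q (c, false) := fun h => by simpa using hinj h
    have hcol := hcolor _ _ (shareEdge_of_flatAt (q := fun b => q (c, b)) (hy1 h2 h1) (hy2 h2 h1).2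
      (by simpa only [hc] using hy3 h1) hne)
    simp only [black]
    revert hcol
    cases color (q (c, true)) <;> cases color (q (c, false)) <;> decide
  rw [crossingSum, ← hrange, finsum_mem_range hinj, finsum_eq_sum_of_fintype,
    Fintype.sum_prod_type]
  simp only [Fintype.sum_bool, key]
  decide

theorem crossingSum_white (hP : P.Irreducible) {color : P.Region → Bool}
    (hcolor : IsCheckerboard color) (x : P.Crossing) :
    crossingSum (black fun r => !color r) x = 0 :=
  crossingSum_black hP (fun r r' h => by simpa using hcolor r r' h) x

/-! ### The jumps of an arc of the curve -/

/-- The indicator function of `L` changes by `k` at the parameter `s`. -/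
def ChangesBy (L : Set (AddCircle (1 : ℝ))) (s : AddCircle (1 : ℝ)) (k : ZMod 2) : Prop :=
  ∃ (a : ℝ) (d : ZMod 2), (a : AddCircle (1 : ℝ)) = s ∧
    ∀ᶠ u : ℝ in 𝓝 a, u ≠ a → L.indicator 1 (u : AddCircle (1 : ℝ)) = d + if isPos (u - a) then k else 0

/-- The open arc of the circle from `a` to `b`. -/
def arc (a b : ℝ) : Set (AddCircle (1 : ℝ)) := (fun u : ℝ => (u : AddCircle (1 : ℝ))) '' Ioo a b

theorem coe_mem_arc_iff {a b c u : ℝ} (hab : Ioo a b ⊆ Ico c (c + 1)) (hu : u ∈ Ico c (c + 1)) :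
    (u : AddCircle (1 : ℝ)) ∈ arc a b ↔ u ∈ Ioo a b := by
  refine ⟨?_, fun h => ⟨u, h, rfl⟩⟩
  rintro ⟨v, hv, hvu⟩
  rwa [← (AddCircle.coe_eq_coe_iff_of_mem_Ico (hab hv) hu).1 hvu]

theorem changesBy_arc_left {a b : ℝ} (hab : a < b) (hb : b < a + 1) :
    ChangesBy (arc a b) (a : AddCircle (1 : ℝ)) 1 := by
  refine ⟨a, 0, rfl, ?_⟩
  filter_upwards [Ioo_mem_nhds (show b - 1 < a by linarith) hab] with u hu hne
  have h : (u : AddCircle (1 : ℝ)) ∈ arc a b ↔ u ∈ Ioo a b :=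
    -- The period starting at `b - 1` contains both the arc and a neighbourhood of `a`.
    coe_mem_arc_iff (c := b - 1) (fun v hv => ⟨by linarith [hv.1], by linarith [hv.2]⟩)
      ⟨hu.1.le, by linarith [hu.2]⟩
  rcases hne.lt_or_gt with h1 | h1
  · rw [indicator_of_notMem fun h2 => absurd (h.1 h2).1 h1.not_gt]
    simp [isPos, h1.le]
  · rw [indicator_of_mem (h.2 ⟨h1, hu.2⟩)]
    simp [isPos, h1]

theorem changesBy_arc_right {a b : ℝ} (hab : a < b) (hb : b < a + 1) :
    ChangesBy (arc a b) (b : AddCircle (1 : ℝ)) 1 := by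
  refine ⟨b, 1, rfl, ?_⟩
  filter_upwards [Ioo_mem_nhds hab hb] with u hu hne
  have h : (u : AddCircle (1 : ℝ)) ∈ arc a b ↔ u ∈ Ioo a b :=
    coe_mem_arc_iff (c := a) (fun v hv => ⟨hv.1.le, hv.2.trans hb⟩) ⟨hu.1.le, hu.2⟩
  rcases hne.lt_or_gt with h1 | h1
  · rw [indicator_of_mem (h.2 ⟨hu.1, h1⟩)]
    simp [isPos, h1.le]
  · rw [indicator_of_notMem fun h2 => absurd (h.1 h2).2 h1.not_gt]
    simp [isPos, h1, CharTwo.add_self_eq_zero]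

theorem eventually_coe {a : ℝ} {p : AddCircle (1 : ℝ) → Prop} :
    (∀ᶠ u in 𝓝 (a : AddCircle (1 : ℝ)), p u) ↔ ∀ᶠ u : ℝ in 𝓝 a, p u := by
  rw [QuotientAddGroup.nhds_eq, eventually_map]

theorem eventually_indicator_arc {a b : ℝ} (hb : b < a + 1)
    {z : AddCircle (1 : ℝ)} (hza : z ≠ a) (hzb : z ≠ b) :
    ∀ᶠ u in 𝓝 z, (arc a b).indicator (1 : AddCircle (1 : ℝ) → ZMod 2) u
      = (arc a b).indicator 1 z := by
  obtain ⟨c, hc, rfl⟩ : z ∈ (fun u : ℝ => (u : AddCircle (1 : ℝ))) '' Ico a (a + 1) := by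
    have := AddCircle.coe_image_Ico_eq (1 : ℝ) a
    exact this ▸ mem_univ z
  have hca : a < c := lt_of_le_of_ne hc.1 fun h => hza (by rw [h])
  have hcb : c ≠ b := fun h => hzb (by rw [h])
  have hmem : ∀ u ∈ Ioo a (a + 1), (u : AddCircle (1 : ℝ)) ∈ arc a b ↔ u < b := fun u hu =>
    (coe_mem_arc_iff (c := a) (fun v hv => ⟨hv.1.le, hv.2.trans hb⟩) ⟨hu.1.le, hu.2⟩).trans
      (and_iff_right hu.1)
  have hsame : ∀ᶠ u : ℝ in 𝓝 c, (u < b ↔ c < b) := by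
    rcases hcb.lt_or_gt with h | h
    · filter_upwards [eventually_lt_nhds h] with u hu using iff_of_true hu h
    · filter_upwards [eventually_gt_nhds h] with u hu using iff_of_false hu.not_gt h.not_gt
  rw [eventually_coe]
  filter_upwards [Ioo_mem_nhds hca hc.2, hsame] with u hu hu'
  rw [indicator, indicator]
  simp only [hmem u hu, hmem c ⟨hca, hc.2⟩, hu', Pi.one_apply]

theorem changesBy_zero {L : Set (AddCircle (1 : ℝ))} {z : AddCircle (1 : ℝ)}
    (h : ∀ᶠ u in 𝓝 z, L.indicator (1 : AddCircle (1 : ℝ) → ZMod 2) u = L.indicator 1 z) :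
    ChangesBy L z 0 := by
  obtain ⟨a, rfl⟩ := QuotientAddGroup.mk_surjective z
  refine ⟨a, L.indicator 1 (a : AddCircle (1 : ℝ)), rfl, (eventually_coe.1 h).mono fun u hu _ => ?_⟩
  simpa using hu

/-- Along a branch through a double point, the parameter is a monotone function of the coordinate. -/
theorem BranchChart.exists_direction {e : OpenPartialHomeomorph S2 (ℝ × ℝ)}
    {s t : AddCircle (1 : ℝ)} (h : BranchChart P e s t) {a : ℝ}
    (ha : (a : AddCircle (1 : ℝ)) = s) :
    ∃ r : Bool, ∀ᶠ u : ℝ in 𝓝 a, u ≠ a →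
      isPos (u - a) = xor (isPos (e (P.curve u)).1) r := by
  subst ha
  have hcont : Continuous fun u : ℝ => P.curve u :=
    P.continuous_curve.comp (AddCircle.continuous_mk' 1)
  have hev : ∀ᶠ u : ℝ in 𝓝 a, (P.curve u ∈ e.source ∧ (e (P.curve u)).2 = 0) ∧
      (u : AddCircle (1 : ℝ)) ≠ t ∧ (P.curve u ≠ P.curve a → P.curve u ∉ P.crossings) := by
    refine ((hcont.continuousAt.eventually (e.open_source.mem_nhds h.crossAt.mem_source)).and
      (eventually_coe.1 h.snd_eq)).and ((eventually_coe.1 (eventually_ne_nhds h.ne)).and ?_)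
    exact hcont.continuousAt.eventually (eventually_notMem_crossings (P.curve a))
  obtain ⟨ε, hε, hball⟩ := Metric.nhds_basis_closedBall.eventually_iff.1
    (hev.and (Metric.closedBall_mem_nhds a (show (0 : ℝ) < 1 / 3 by norm_num)))
  rw [Real.closedBall_eq_Icc] at hball
  set g : ℝ → ℝ := fun u => (e (P.curve u)).1 with hg
  have hga : g a = 0 := by simp [hg, h.crossAt.eq_zero]
  have hgc : ContinuousOn g (Icc (a - ε) (a + ε)) := fun u hu =>
    ((continuous_fst.continuousAt.comp (e.continuousAt (hball hu).1.1.1)).comp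
      (f := fun u : ℝ => P.curve u) hcont.continuousAt).continuousWithinAt
  -- Equal first coordinates give equal points, since the second ones vanish. Near the crossing
  -- there is no other double point, and within `1 / 3` of `a` a parameter is determined by its
  -- class.
  have hginj : InjOn g (Icc (a - ε) (a + ε)) := by
    intro u hu u' hu' heq
    obtain ⟨⟨⟨h1, h2⟩, h3, h4⟩, h5⟩ := hball hu
    obtain ⟨⟨⟨h1', h2'⟩, h3', h4'⟩, h5'⟩ := hball hu'
    replace h5 := abs_le.1 (show |u - a| ≤ 1 / 3 from h5)
    replace h5' := abs_le.1 (show |u' - a| ≤ 1 / 3 from h5')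
    have hcurve : P.curve u = P.curve u' := e.injOn h1 h1' (Prod.ext heq (h2.trans h2'.symm))
    have hcoe : (u : AddCircle (1 : ℝ)) = u' := by
      by_contra hne
      have hua : P.curve u = P.curve a := by
        by_contra hc
        exact h4 hc ⟨u, u', hne, rfl, hcurve.symm⟩
      exact hne (((h.param_eq hua).resolve_right h3).trans
        ((h.param_eq (hcurve ▸ hua)).resolve_right h3').symm)
    refine (AddCircle.coe_eq_coe_iff_of_mem_Ico (a := a - 1 / 3) ?_ ?_).1 hcoe
    · exact ⟨by linarith [h5.1], by linarith [h5.2]⟩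
    · exact ⟨by linarith [h5'.1], by linarith [h5'.2]⟩
  have haI : a ∈ Icc (a - ε) (a + ε) := ⟨by linarith, by linarith⟩
  have hnhds : Icc (a - ε) (a + ε) ∈ 𝓝 a := Icc_mem_nhds (by linarith) (by linarith)
  rcases hgc.strictMonoOn_of_injOn_Icc' (by linarith) hginj with hm | hm
  · refine ⟨false, ?_⟩
    filter_upwards [hnhds] with u hu hne
    have := hm.lt_iff_lt haI hu
    rw [hga] at this
    rw [Bool.xor_false, isPos, isPos, decide_eq_decide, sub_pos]
    exact this.symm
  · refine ⟨true, ?_⟩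
    filter_upwards [hnhds] with u hu hne
    have h1 := hm.lt_iff_gt haI hu
    have h2 := hm.lt_iff_gt hu haI
    rw [hga] at h1 h2
    change _ = xor (isPos (g u)) true
    rcases hne.lt_or_gt with hlt | hlt
    · have := h1.2 hlt
      simp [isPos, hlt.le, this]
    · have := h2.2 hlt
      simp [isPos, hlt, this.le]

/-- The jumps across the part of the curve with parameters in `L`. -/
def arcJump (P : KnotProjection) (L : Set (AddCircle (1 : ℝ))) : S2 → ZMod 2 :=
  (P.curve '' L).indicator 1

theorem arcJump_curve {L : Set (AddCircle (1 : ℝ))} {u : AddCircle (1 : ℝ)}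
    (hu : P.curve u ∉ P.crossings) : P.arcJump L (P.curve u) = L.indicator 1 u := by
  have : P.curve u ∈ P.curve '' L ↔ u ∈ L := by
    refine ⟨?_, fun h => ⟨u, h, rfl⟩⟩
    rintro ⟨v, hv, hvu⟩
    by_contra h
    exact hu ⟨v, u, fun heq => h (heq ▸ hv), hvu, rfl⟩
  by_cases h : u ∈ L
  · rw [arcJump, indicator_of_mem (this.2 h), indicator_of_mem h, Pi.one_apply, Pi.one_apply]
  · rw [arcJump, indicator_of_notMem (fun h' => h (this.1 h')), indicator_of_notMem h]

/-- Transfers a change in the parameter to a change in the coordinate. If the branch runs backwards,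
the base value shifts by `k`. -/
theorem BranchChart.exists_arcJump {e : OpenPartialHomeomorph S2 (ℝ × ℝ)}
    {s t : AddCircle (1 : ℝ)} (h : BranchChart P e s t) {L : Set (AddCircle (1 : ℝ))} {k : ZMod 2}
    (hk : ChangesBy L s k) :
    ∃ d, ∀ᶠ y in 𝓝 (P.curve s), (e y).2 = 0 → (e y).1 ≠ 0 →
      P.arcJump L y = d + if isPos (e y).1 then k else 0 := by
  obtain ⟨a, d, rfl, hd⟩ := hk
  obtain ⟨r, hr⟩ := h.exists_direction rfl
  refine ⟨d + if r then k else 0, ?_⟩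
  have hev : ∀ᶠ u in 𝓝 (a : AddCircle (1 : ℝ)), u ≠ (a : AddCircle (1 : ℝ)) → L.indicator 1 u
      = (d + if r then k else 0) + if isPos (e (P.curve u)).1 then k else 0 := by
    rw [eventually_coe]
    filter_upwards [hd, hr] with u hu hu' hne
    have hua : u ≠ a := fun h => hne (by rw [h])
    rw [hu hua, hu' hua, add_assoc]
    congr 1
    cases isPos (e (P.curve u)).1 <;> cases r <;> simp [CharTwo.add_self_eq_zero]
  filter_upwards [h.eventually_param hev, h.eventually_simple] with y hy hy' h2 h1
  obtain ⟨⟨u, rfl⟩, hc⟩ := hy' h2 h1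
  rw [arcJump_curve hc]
  refine hy h1 u rfl ?_
  rintro rfl
  exact h1 (by rw [h.crossAt.eq_zero])

/-! ### Local solutions for the jumps of an arc -/

theorem exists_hasJumpsOn_nhds {j f : S2 → ZMod 2} {x : S2}
    (h1 : ∀ᶠ y in 𝓝 x, LocConstOff P.image f y)
    (h2 : ∀ᶠ y in 𝓝 x, y ∈ P.image → y ∉ P.crossings → HasJump P.image f y (j y)) :
    ∃ U ∈ 𝓝 x, ∃ f, HasJumpsOn P j f U :=
  ⟨_, h1.and h2, f, fun _ hy => hy.1, fun _ hy => hy.2⟩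

theorem exists_hasJumpsOn_arcJump_of_simple {L : Set (AddCircle (1 : ℝ))}
    {u : AddCircle (1 : ℝ)} (hu : P.curve u ∉ P.crossings)
    (hL : ∀ᶠ u' in 𝓝 u, L.indicator (1 : AddCircle (1 : ℝ) → ZMod 2) u' = L.indicator 1 u) :
    ∃ U ∈ 𝓝 (P.curve u), ∃ f, HasJumpsOn P (P.arcJump L) f U := by
  obtain ⟨e, he⟩ := exists_flatAt (P := P) ⟨u, rfl⟩ hu
  have hparam : ∀ᶠ y in 𝓝 (P.curve u), ∀ u', P.curve u' = y →
      L.indicator (1 : AddCircle (1 : ℝ) → ZMod 2) u' = L.indicator 1 u := by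
    refine eventually_forall_param fun u' hu' => ?_
    obtain rfl : u' = u := by
      by_contra hne
      exact hu ⟨u', u, hne, hu', rfl⟩
    exact hL
  refine exists_hasJumpsOn_nhds (f := fun z => 0 + if isPos (e z).2 then L.indicator 1 u else 0)
    ?_ ?_
  · filter_upwards [he.mem_iff, e.open_source.mem_nhds he.mem_source] with y hy hys hyK
    filter_upwards [(tendsto_chart_snd hys).eventually
      (eventually_isPos_eq fun h => hyK (hy.2 h))] with z hz
    rw [hz.2]
  · filter_upwards [he.eventually, hparam] with y hy hy' hyK hyc
    refine ⟨e, hy hyK, 0, Eventually.of_forall fun z _ => ?_⟩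
    obtain ⟨u', rfl⟩ := hyK
    rw [arcJump_curve hyc, hy' u' rfl]

/-- Values on the four quadrants with prescribed jumps across the coordinate axes. -/
def quadrantValue (d d' k : ZMod 2) (b c : Bool) : ZMod 2 :=
  ((if b then 0 else d' + k) + if c then 0 else d + k) + if b || c then 0 else k

theorem quadrantValue_add_fst : ∀ (d d' k : ZMod 2) (b : Bool),
    quadrantValue d d' k b true + quadrantValue d d' k b false = d + if b then k else 0 := by
  decide

theorem quadrantValue_add_snd : ∀ (d d' k : ZMod 2) (c : Bool),
    quadrantValue d d' k true c + quadrantValue d d' k false c = d' + if c then k else 0 := by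
  decide

/-- The prescribed jumps on the half-axes are `d`, `d + k` and `d'`, `d' + k`. They sum to 0 around
the crossing because both branches change by the same `k`, so quadrant values exist. -/
theorem exists_hasJumpsOn_arcJump_of_double {L : Set (AddCircle (1 : ℝ))}
    {s t : AddCircle (1 : ℝ)} (hne : s ≠ t) (heq : P.curve s = P.curve t) {k : ZMod 2}
    (hs : ChangesBy L s k) (ht : ChangesBy L t k) :
    ∃ U ∈ 𝓝 (P.curve s), ∃ f, HasJumpsOn P (P.arcJump L) f U := by
  obtain ⟨e, he⟩ := exists_branchChart hne heq
  obtain ⟨d, hd⟩ := he.exists_arcJump hs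
  obtain ⟨d', hd'⟩ := he.swap.exists_arcJump ht
  rw [← heq] at hd'
  set v := quadrantValue d d' k
  set f : S2 → ZMod 2 := fun z => v (isPos (e z).1) (isPos (e z).2)
  have hvf : ∀ᶠ z in 𝓝 (P.curve s), z ∉ P.image → f z = v (isPos (e z).1) (isPos (e z).2) :=
    Eventually.of_forall fun z _ => rfl
  refine exists_hasJumpsOn_nhds (f := f) ?_ ?_
  · filter_upwards [he.crossAt.mem_iff, e.open_source.mem_nhds he.crossAt.mem_source]
      with y hy hys hyK
    filter_upwards [
      (tendsto_chart_fst hys).eventually (eventually_isPos_eq fun h => hyK (hy.2 (Or.inl h))),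
      (tendsto_chart_snd hys).eventually (eventually_isPos_eq fun h => hyK (hy.2 (Or.inr h)))]
      with z hz hz'
    simp only [f, hz.2, hz'.2]
  · have hs : P.curve s ∈ P.crossings := ⟨s, t, hne, rfl, heq.symm⟩
    filter_upwards [he.crossAt.mem_iff, e.open_source.mem_nhds he.crossAt.mem_source, hd, hd',
      he.crossAt.eventually_hasJump hvf, he.crossAt.eventually_hasJump_swap hvf]
      with y hy hys h1 h2 h3 h4 hyK hyc
    have hzero : (e y).1 = 0 → (e y).2 ≠ 0 := fun h5 h6 => by
      have : y = P.curve s := e.injOn hys he.crossAt.mem_source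
        (by rw [he.crossAt.eq_zero]; exact Prod.ext h5 h6)
      exact hyc (this ▸ hs)
    rcases hy.1 hyK with h5 | h5
    · rw [h2 h5 (hzero h5)]
      rw [swapChart_apply, ← quadrantValue_add_snd d d' k]
      exact h4 h5 (hzero h5)
    · have h6 : (e y).1 ≠ 0 := fun h6 => hzero h6 h5
      rw [h1 h5 h6, ← quadrantValue_add_fst d d' k]
      exact h3 h5 h6

/-! ### Surjectivity -/

theorem exists_onSphere_eq {f : S2 → ZMod 2} (hf : ∀ x, LocConstOff P.image f x) :
    ∃ F : P.Region → ZMod 2, ∀ x, x ∉ P.image → onSphere F x = f x := by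
  choose p hp using region_exists_mem (P := P)
  refine ⟨fun r => f (p r), fun x hx => ?_⟩
  set r : P.Region := ⟨P.regionOf x, regionOf_mem_regions hx⟩
  rw [onSphere_of_eq (r := r) _ rfl]
  refine IsPreconnected.constant_of_eventually (s := P.regionOf x)
    isPreconnected_connectedComponentIn (fun y hy => nhdsWithin_le_nhds (hf y ?_)) (hp r)
    (mem_connectedComponentIn hx)
  exact connectedComponentIn_subset _ _ hy

/-- The arc between the two parameters of `c` is a closed loop on the sphere. Its indicator changes
along a branch only at `c`, so a function with these jumps has crossing sum 1 there alone. -/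
theorem exists_crossingSum_eq_single (hP : P.Irreducible) (c : P.Crossing) :
    ∃ F : P.Region → ZMod 2, ∀ x, crossingSum F x = ({c} : Set P.Crossing).indicator 1 x := by
  classical
  obtain ⟨c, s₀, t₀, hne, hs₀, ht₀⟩ := c
  obtain ⟨a, rfl⟩ := QuotientAddGroup.mk_surjective s₀
  obtain ⟨b, hb, rfl⟩ : t₀ ∈ (fun u : ℝ => (u : AddCircle (1 : ℝ))) '' Ico a (a + 1) := by
    have := AddCircle.coe_image_Ico_eq (1 : ℝ) a
    exact this ▸ mem_univ t₀
  have hab : a < b := lt_of_le_of_ne hb.1 fun h => hne (by rw [h])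
  set L := arc a b
  have hchange : ∀ z, ChangesBy L z (if P.curve z = c then 1 else 0) := by
    intro z
    split_ifs with hz
    · rcases (P.double_point _ _ hne (hs₀.trans ht₀.symm)).1 z (hz.trans hs₀.symm) with rfl | rfl
      · exact changesBy_arc_left hab hb.2
      · exact changesBy_arc_right hab hb.2
    · refine changesBy_zero (eventually_indicator_arc hb.2 ?_ ?_)
      · rintro rfl
        exact hz hs₀
      · rintro rfl
        exact hz ht₀
  obtain ⟨f, hf⟩ := exists_hasJumpsOn_univ (P := P) (P.arcJump L) fun x => by
    by_cases hx : x ∈ P.image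
    · by_cases hxc : x ∈ P.crossings
      · obtain ⟨s, t, hst, rfl, hts⟩ := hxc
        have ht := hchange t
        rw [hts] at ht
        exact exists_hasJumpsOn_arcJump_of_double hst hts.symm (hchange s) ht
      · obtain ⟨u, rfl⟩ := hx
        refine exists_hasJumpsOn_arcJump_of_simple hxc (eventually_indicator_arc hb.2 ?_ ?_)
        · rintro rfl
          exact hxc ⟨_, _, hne, rfl, ht₀.trans hs₀.symm⟩
        · rintro rfl
          exact hxc ⟨_, _, hne, hs₀.trans ht₀.symm, rfl⟩
    · exact ⟨P.imageᶜ, isClosed_image.isOpen_compl.mem_nhds hx, 0,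
        fun y _ _ => Eventually.of_forall fun _ => rfl, fun y hy hyK => absurd hyK hy⟩
  obtain ⟨F, hF⟩ := exists_onSphere_eq fun x => hf.1 x (mem_univ x)
  have hjump : ∀ x ∈ P.image, x ∉ P.crossings → HasJump P.image (onSphere F) x (P.arcJump L x) :=
    fun x hxK hxc => (hf.2 x (mem_univ x) hxK hxc).congr 0
      (Eventually.of_forall fun y hy => by rw [hF y hy, add_zero])
  refine ⟨F, fun x => ?_⟩
  obtain ⟨e, s, t, he, hx⟩ := crossing_exists_chart x.2
  have hcross : CrossAt P.image e (x : S2) := hx ▸ he.crossAt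
  obtain ⟨v, hv, hsum⟩ := exists_crossing_values hP hcross F
  rw [← hx] at hv
  obtain ⟨d, hd⟩ := he.exists_arcJump (hchange s)
  have hval : ∀ σ : Bool, v σ true + v σ false
      = d + if σ then (if P.curve s = c then 1 else 0) else 0 := fun σ => by
    refine he.values_eq hv σ ?_
    filter_upwards [hd, he.eventually_simple] with y hy hy' h2 h1 hσ
    rw [← hσ, ← hy h2 h1]
    exact hjump y (hy' h2 h1).1 (hy' h2 h1).2
  -- With `k` the change at `x`, the sum is `(d + k) + d = k`.
  rw [hsum, hval, hval, hx]
  have hxc : x ∈ ({(⟨c, _, _, hne, hs₀, ht₀⟩ : P.Crossing)} : Set P.Crossing) ↔ (x : S2) = c := by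
    rw [mem_singleton_iff, Subtype.ext_iff]
  simp only [indicator, hxc, Pi.one_apply]
  generalize (if (x : S2) = c then (1 : ZMod 2) else 0) = k
  clear * -
  revert d k
  decide

theorem exists_crossingSum_eq (hP : P.Irreducible) (D : Set P.Crossing) :
    ∃ F : P.Region → ZMod 2, ∀ x, crossingSum F x = D.indicator 1 x := by
  have : Finite P.Crossing := P.finite_double
  induction D, D.toFinite using Set.Finite.induction_on with
  | empty => exact ⟨0, fun x => by simp [crossingSum]⟩
  | @insert c D hc _ ih =>
    obtain ⟨F, hF⟩ := ih
    obtain ⟨G, hG⟩ := exists_crossingSum_eq_single hP c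
    refine ⟨G + F, fun x => ?_⟩
    rw [crossingSum_add hP, hF, hG, insert_eq,
      indicator_union_of_disjoint (disjoint_singleton_left.2 hc)]

/-! ### The effect map on `P(S)` -/

theorem crossingSum_indicator_eq_one_iff (hP : P.Irreducible) (T : Set P.Region)
    (x : P.Crossing) : crossingSum (T.indicator 1) x = 1 ↔ x ∈ effect T := by
  rw [← mem_effect_iff hP]
  have : {r | T.indicator (1 : P.Region → ZMod 2) r = 1} = T := by
    ext r
    by_cases h : r ∈ T <;> simp [h]
  rw [this]

theorem phi_injective (hP : P.Irreducible) {color : P.Region → Bool}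
    (hcolor : IsCheckerboard color) {b w : P.Region} (hb : color b = true)
    (hw : color w = false) : Function.Injective (phi {r | r ≠ b ∧ r ≠ w}) := by
  intro a c hac
  have hsum : ∀ x, crossingSum (a.carrier.indicator 1 + c.carrier.indicator 1) x = 0 := by
    intro x
    rw [crossingSum_add hP, CharTwo.add_eq_zero]
    have h : crossingSum (a.carrier.indicator 1) x = 1
        ↔ crossingSum (c.carrier.indicator 1) x = 1 := by
      rw [crossingSum_indicator_eq_one_iff hP, crossingSum_indicator_eq_one_iff hP]
      exact Set.ext_iff.1 hac x
    exact (by decide : ∀ p q : ZMod 2, (p = 1 ↔ q = 1) → p = q) _ _ h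
  have hzero : ∀ a : SubsetOf {r : P.Region | r ≠ b ∧ r ≠ w},
      a.carrier.indicator (1 : P.Region → ZMod 2) b = 0 ∧
      a.carrier.indicator (1 : P.Region → ZMod 2) w = 0 := fun a =>
    ⟨indicator_of_notMem (fun h => (a.subset h).1 rfl) _,
      indicator_of_notMem (fun h => (a.subset h).2 rfl) _⟩
  have key := eq_zero_of_crossingSum_eq_zero hP hcolor hb hw hsum
    (by rw [Pi.add_apply, (hzero a).1, (hzero c).1, add_zero])
    (by rw [Pi.add_apply, (hzero a).2, (hzero c).2, add_zero])
  ext r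
  have hr : a.carrier.indicator (1 : P.Region → ZMod 2) r = c.carrier.indicator 1 r :=
    CharTwo.add_eq_zero.1 (congrFun key r)
  by_cases h : r ∈ a.carrier <;> by_cases h' : r ∈ c.carrier <;> simp [h, h'] at hr ⊢

theorem phi_surjective (hP : P.Irreducible) {color : P.Region → Bool}
    (hcolor : IsCheckerboard color) {b w : P.Region} (hb : color b = true)
    (hw : color w = false) : Function.Surjective (phi {r | r ≠ b ∧ r ≠ w}) := by
  intro D
  obtain ⟨F, hF⟩ := exists_crossingSum_eq hP D
  -- Adding `G`, which has zero crossing sums, corrects the value at `r` and leaves the values where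
  -- `G` vanishes. The white indicator vanishes at `b`, so the second correction keeps the first.
  have adjust : ∀ (F G : P.Region → ZMod 2) (r : P.Region), G r = 1 →
      (∀ x, crossingSum F x = D.indicator 1 x) → (∀ x, crossingSum G x = 0) →
      ∃ F' : P.Region → ZMod 2, (∀ x, crossingSum F' x = D.indicator 1 x) ∧ F' r = 0 ∧
        ∀ r', G r' = 0 → F' r' = F r' := by
    intro F G r hG hF hG0
    obtain h | h : F r = 0 ∨ F r = 1 := (by decide : ∀ d : ZMod 2, d = 0 ∨ d = 1) _
    · exact ⟨F, hF, h, fun _ _ => rfl⟩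
    · refine ⟨F + G, fun x => ?_, ?_, fun r' hr' => ?_⟩
      · rw [crossingSum_add hP, hF, hG0, add_zero]
      · rw [Pi.add_apply, h, hG, CharTwo.add_self_eq_zero]
      · rw [Pi.add_apply, hr', add_zero]
  obtain ⟨F₁, hF₁, hb₁, -⟩ := adjust F (black color) b (by simp [black, hb]) hF
    (crossingSum_black hP hcolor)
  obtain ⟨F₂, hF₂, hw₂, h₂⟩ := adjust F₁ (black fun r => !color r) w (by simp [black, hw]) hF₁
    (crossingSum_white hP hcolor)
  have hb₂ : F₂ b = 0 := by rw [h₂ b (by simp [black, hb]), hb₁]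
  refine ⟨⟨{r | F₂ r = 1}, fun r hr => ⟨?_, ?_⟩⟩, ?_⟩
  · rintro rfl
    exact zero_ne_one (hb₂.symm.trans hr)
  · rintro rfl
    exact zero_ne_one (hw₂.symm.trans hr)
  · ext x
    rw [phi, mem_effect_iff hP, hF₂]
    by_cases h : x ∈ D <;> simp [h]

theorem phi_empty (S : Set P.Region) : phi S ⟨∅, empty_subset S⟩ = ∅ := by
  ext x
  simp [phi, effect]

end KnotProjection

/-- The Boolean algebra structure transported along a bijection. -/
abbrev Equiv.pullbackBooleanAlgebra {α β : Type*} [BooleanAlgebra β] (φ : α ≃ β) :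
    BooleanAlgebra α :=
  letI : Max α := ⟨fun a c => φ.symm (φ a ⊔ φ c)⟩
  letI : Min α := ⟨fun a c => φ.symm (φ a ⊓ φ c)⟩
  letI : LE α := ⟨fun a c => φ a ≤ φ c⟩
  letI : LT α := ⟨fun a c => φ a < φ c⟩
  letI : Top α := ⟨φ.symm ⊤⟩
  letI : Bot α := ⟨φ.symm ⊥⟩
  letI : Compl α := ⟨fun a => φ.symm (φ a)ᶜ⟩
  letI : SDiff α := ⟨fun a c => φ.symm (φ a \ φ c)⟩
  letI : HImp α := ⟨fun a c => φ.symm (φ a ⇨ φ c)⟩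
  φ.injective.booleanAlgebra φ Iff.rfl Iff.rfl (fun _ _ => φ.apply_symm_apply _)
    (fun _ _ => φ.apply_symm_apply _) (φ.apply_symm_apply _) (φ.apply_symm_apply _)
    (fun _ => φ.apply_symm_apply _) (fun _ _ => φ.apply_symm_apply _)
    (fun _ _ => φ.apply_symm_apply _)

end

theorem mainTheorem3 (P : KnotProjection) (hP : P.Irreducible)
    (color : P.Region → Bool) (hcolor : KnotProjection.IsCheckerboard color)
    (b w : P.Region) (hb : color b = true) (hw : color w = false)
    (S : Set P.Region) (hS : S = {r | r ≠ b ∧ r ≠ w}) :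
    Function.Bijective (KnotProjection.phi S) ∧
    ∃ φ : KnotProjection.SubsetOf S ≃ Set P.Crossing,
      (∀ a, φ a = KnotProjection.phi S a) ∧
      ∃ _ : BooleanAlgebra (KnotProjection.SubsetOf S),
        (∀ a c : KnotProjection.SubsetOf S, a ⊔ c = φ.symm (φ a ∪ φ c)) ∧
        (∀ a c : KnotProjection.SubsetOf S, a ⊓ c = φ.symm (φ a ∩ φ c)) ∧
        (∀ a c : KnotProjection.SubsetOf S, φ (a ⊔ c) = φ a ∪ φ c) ∧
        (∀ a c : KnotProjection.SubsetOf S, φ (a ⊓ c) = φ a ∩ φ c) ∧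
        (∀ a : KnotProjection.SubsetOf S, φ aᶜ = (φ a)ᶜ) ∧
        φ ⊤ = Set.univ ∧ φ ⊥ = ∅ ∧
        (⊥ : KnotProjection.SubsetOf S).carrier = ∅ ∧
        (∀ a c : KnotProjection.SubsetOf S, a ≤ c ↔ φ a ⊆ φ c) := by
  subst hS
  have hbij : Function.Bijective (KnotProjection.phi {r : P.Region | r ≠ b ∧ r ≠ w}) :=
    ⟨KnotProjection.phi_injective hP hcolor hb hw, KnotProjection.phi_surjective hP hcolor hb hw⟩
  set φ := Equiv.ofBijective _ hbij
  have hbot : φ.symm ∅ = ⟨∅, empty_subset _⟩ :=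
    φ.symm_apply_eq.2 (KnotProjection.phi_empty _).symm
  refine ⟨hbij, φ, fun _ => rfl, φ.pullbackBooleanAlgebra, fun _ _ => rfl, fun _ _ => rfl,
    fun _ _ => φ.apply_symm_apply _, fun _ _ => φ.apply_symm_apply _,
    fun _ => φ.apply_symm_apply _, φ.apply_symm_apply _, φ.apply_symm_apply _, ?_,
    fun _ _ => Iff.rfl⟩
  exact congrArg KnotProjection.SubsetOf.carrier hbot
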